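/- Let $\alpha>0$ and $t>0$, and let $w(x,t)=(1-x^2)^{\alpha}e^{-t/x^2}$ for $x\in[-1,1]$. For $n\ge 0$ let $$D_n(t)=\det\left(\int_{-1}^{1}x^{j+k}w(x,t)\,dx\right)_{j,k=0}^{n-1}\quad(D_0=1),\qquad \sigma_n(t)=2t\,\frac{d}{dt}\ln D_n(t),$$ where $D_n(t)>0$ and $D_n$ is differentiable at $t$. Let $P_n(x,t)$ be the monic polynomial of degree $n$ orthogonal with respect to $w(\cdot,t)$ on $[-1,1]$, let $h_n(t)=\int_{-1}^1P_n(x,t)^2w(x,t)\,dx$ and $$R_n(t)=\frac{2t}{h_n(t)}\int_{-1}^{1}\frac{P_n(y,t)^2\,w(y,t)}{y^2}\,dy .$$ For $n\ge 1$, writing $\sigma_k=\sigma_k(t)$, put $$E_n=2\alpha(n-t)+2(-1)^nt(n+\alpha)+n^2+\sigma_n,$$ $$\Delta_n=(-1)^nt(2n+1+2\alpha)(2n-1+2\alpha)+(n+\alpha)(\sigma_{n-1}-\sigma_n)(\sigma_n-\sigma_{n+1}).$$ Then for every $n\ge1$ (if $n$ is odd, provided that $\Delta_n\ne0$) the following second-order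 nonlinear difference equation holds: $$\left\{n-\frac{(\sigma_{n-1}-\sigma_n)(\sigma_n-\sigma_{n+1})E_n}{2\Delta_n}\right\}\left\{n+2\alpha-\frac{(\sigma_{n-1}-\sigma_n)(\sigma_n-\sigma_{n+1})E_n}{2\Delta_n}\right\}$$ $$=t\,(2n-1+2\alpha+\sigma_{n-1}-\sigma_n)(2n+1+2\alpha+\sigma_n-\sigma_{n+1})\,\frac{E_n}{t(2n+1+2\alpha)(2n-1+2\alpha)+(-1)^n(n+\alpha)(\sigma_{n-1}-\sigma_n)(\sigma_n-\sigma_{n+1})}.$$ The initial conditions are $$\sigma_1(t)=-R_0(t),\qquad \sigma_2(t)=-(R_0(t)+R_1(t)),$$ where, with the confluent hypergeometric function $\Phi(a,b;z)=\sum_{k\ge0}\frac{(a)_k}{(b)_k}\frac{z^k}{k!}$, $$R_0(t)=\frac{2\sqrt t\left[\Gamma(\tfrac32+\alpha)\Phi(-\alpha,\tfrac12;-t)-(1+2\alpha)\sqrt t\,\Gamma(1+\alpha)\Phi(\tfrac12-\alpha,\tfrac32;-t)\right]}{\Gamma(1+\alpha)\Phi(-\tfrac12-\alpha,\tfrac12;-t)-2\sqrt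 t\,\Gamma(\tfrac32+\alpha)\Phi(-\alpha,\tfrac32;-t)},$$ $$R_1(t)=\frac{6t\left[(3+2\alpha)\Gamma(1+\alpha)\Phi(-\tfrac12-\alpha,\tfrac12;-t)-4\sqrt t\,\Gamma(\tfrac52+\alpha)\Phi(-\alpha,\tfrac32;-t)\right]}{3\Gamma(1+\alpha)\Phi(-\tfrac32-\alpha,-\tfrac12;-t)+8t\sqrt t\,\Gamma(\tfrac52+\alpha)\Phi(-\alpha,\tfrac52;-t)}.$$ -/

import Mathlib

open Polynomial

noncomputable section

namespace SingJacobi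

/-- The singularly perturbed Jacobi weight `w(x,t) = (1 - x²)^α exp(-t / x²)`, used for
`x ∈ [-1, 1]`. (At the single point `x = 0` the code gives the value `1` instead of the limit `0`;
the weight enters only through Lebesgue integrals over `[-1, 1]`.) -/
def weight (α t x : ℝ) : ℝ := (1 - x ^ 2) ^ α * Real.exp (-t / x ^ 2)

/-- The moments `μ_j(t) = ∫_{-1}^{1} x^j w(x,t) dx`. -/
def moment (α : ℝ) (j : ℕ) (t : ℝ) : ℝ := ∫ x in (-1 : ℝ)..1, x ^ j * weight α t x

/-- The Hankel determinant `D_n(t) = det (μ_{j+k}(t))_{0 ≤ j, k ≤ n-1}`. In particular `D_0 = 1`. -/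
def hankelDet (α : ℝ) (n : ℕ) (t : ℝ) : ℝ :=
  (Matrix.of fun j k : Fin n => moment α ((j : ℕ) + (k : ℕ)) t).det

/-- `σ_n(t) = 2 t (d/dt) ln D_n(t)`. In particular `σ_0 = 0`. -/
def sigma (α : ℝ) (n : ℕ) (t : ℝ) : ℝ :=
  2 * t * deriv (fun s => Real.log (hankelDet α n s)) t

/-- The inner product `∫_{-1}^{1} p(x) q(x) w(x,t) dx` of two polynomials. -/
def innerW (α t : ℝ) (p q : ℝ[X]) : ℝ :=
  ∫ x in (-1 : ℝ)..1, p.eval x * q.eval x * weight α t x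

/-- The monic orthogonal polynomials `P_n(x,t)` for the weight `w(x,t)`, obtained from the monomials
by the Gram-Schmidt process without normalization. -/
def orthPoly (α t : ℝ) (n : ℕ) : ℝ[X] :=
  X ^ n - ∑ j : Fin n,
    C (innerW α t (X ^ n) (orthPoly α t j) / innerW α t (orthPoly α t j) (orthPoly α t j)) *
      orthPoly α t j
termination_by n
decreasing_by all_goals exact j.isLt

/-- The squared norm `h_n(t) = ∫_{-1}^{1} P_n(x,t)² w(x,t) dx`. -/
def sqNorm (α : ℝ) (n : ℕ) (t : ℝ) : ℝ := innerW α t (orthPoly α t n) (orthPoly α t n)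

/-- `R_n(t) = (2 t / h_n(t)) ∫_{-1}^{1} P_n(y,t)² w(y,t) / y² dy`. -/
def bigR (α : ℝ) (n : ℕ) (t : ℝ) : ℝ :=
  2 * t / sqNorm α n t *
    ∫ y in (-1 : ℝ)..1, (orthPoly α t n).eval y ^ 2 * weight α t y / y ^ 2

/-- The confluent hypergeometric (Kummer) function
`Φ(a, b; z) = ∑_k (a)_k / (b)_k * z^k / k!`, for `b` not a nonpositive integer. -/
def kummer (a b z : ℝ) : ℝ :=
  ∑' k : ℕ, (ascPochhammer ℝ k).eval a / (ascPochhammer ℝ k).eval b * (z ^ k / (k.factorial : ℝ))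

end SingJacobi

end

/-! The factor `exp (-t / x²)` is flat at the origin, so all integrals `∫ p w x⁻ᵏ` with `p` a
polynomial converge. They obey two rules: cancelling powers of `x`, and the Pearson identity
`laurentInt_pearson`, which is integration by parts.

Since `D_n` is the product of the `h_k` and `h_k' = -∫ P_k² w / x²`, one gets `σ_n = -∑_{k<n} R_k`,
so `R_n = σ_n - σ_{n+1}`. Put `β_n = h_n / h_{n-1}` and `c_n = (2t / h_{n-1}) ∫ P_n P_{n-1} w / x³`.
The three term recurrence and the Pearson identity give first order difference relations between
`β`, `c`, `R` (`ladderC_succ`, `recCoeff_succ_mul_bigR_sub`, `recCoeff_succ_sub`). By induction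
these sum to three algebraic identities at a single index (`compatibility`). Two eliminations then
express `β_n` and `c_n` through the `σ`'s: `β_n = t E_n / ((-1)^n Δ_n)` and `c_n = -R_n R_{n-1} E_n
/ (2 Δ_n)`. Substituting both into the first identity is the difference equation.

For the initial values, set `t = s²`. The functions `∫ w` and `s ∫ w / x²` of `s` satisfy a linear
first order system, and the stated Kummer combinations satisfy the same system. After normalization
both pairs have the same limits as `s → 0⁺`, so they coincide (`linear_system_eq_zero`). Then `P_0 =
1` and `P_1 = X` give `R_0` and `R_1`. -/

open Polynomial

noncomputable section

namespace SingJacobi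

open MeasureTheory Set Filter Topology

/-! ### The weight and its decay at the origin -/

section Weight

variable {α t x : ℝ}

theorem one_sub_sq_nonneg (hx : x ∈ Icc (-1 : ℝ) 1) : 0 ≤ 1 - x ^ 2 := by
  nlinarith [hx.1, hx.2]

theorem weight_nonneg (hx : x ∈ Icc (-1 : ℝ) 1) : 0 ≤ weight α t x :=
  mul_nonneg (Real.rpow_nonneg (one_sub_sq_nonneg hx) _) (Real.exp_pos _).le

theorem weight_pos (hx : x ∈ Ioo (-1 : ℝ) 1) : 0 < weight α t x :=
  mul_pos (Real.rpow_pos_of_pos (by nlinarith [hx.1, hx.2]) _) (Real.exp_pos _)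

theorem weight_neg (α t x : ℝ) : weight α t (-x) = weight α t x := by
  simp [weight]

theorem weight_le_exp (hα : 0 < α) (hx : x ∈ Icc (-1 : ℝ) 1) :
    weight α t x ≤ Real.exp (-t / x ^ 2) := by
  have h : (1 - x ^ 2) ^ α ≤ 1 :=
    Real.rpow_le_one (one_sub_sq_nonneg hx) (by nlinarith [sq_nonneg x]) hα.le
  calc weight α t x ≤ 1 * Real.exp (-t / x ^ 2) :=
        mul_le_mul_of_nonneg_right h (Real.exp_pos _).le
    _ = _ := one_mul _

theorem weight_anti {s : ℝ} (hst : s ≤ t) (hx : x ∈ Icc (-1 : ℝ) 1) :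
    weight α t x ≤ weight α s x := by
  refine mul_le_mul_of_nonneg_left ?_ (Real.rpow_nonneg (one_sub_sq_nonneg hx) _)
  gcongr

/-- This is `exp (-y) ≤ k! / yᵏ` at `y = t / x²`; it makes every negative moment finite. -/
theorem weight_le_pow (hα : 0 < α) (ht : 0 < t) (hx : x ∈ Icc (-1 : ℝ) 1) (hx0 : x ≠ 0) (k : ℕ) :
    weight α t x ≤ k.factorial / t ^ k * x ^ (2 * k) := by
  refine (weight_le_exp hα hx).trans ?_
  have hy : 0 < t / x ^ 2 := by positivity
  have h1 := Real.pow_div_factorial_le_exp (t / x ^ 2) hy.le k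
  rw [neg_div, Real.exp_neg]
  have h2 : 0 < (t / x ^ 2) ^ k / (k.factorial : ℝ) := by positivity
  refine (inv_anti₀ h2 h1).trans_eq ?_
  rw [div_pow, ← pow_mul]
  field_simp

theorem abs_weight_div_pow_le (hα : 0 < α) (ht : 0 < t) (hx : x ∈ Icc (-1 : ℝ) 1) (hx0 : x ≠ 0)
    (k : ℕ) : |weight α t x / x ^ k| ≤ k.factorial / t ^ k * |x| ^ k := by
  have h1 := weight_le_pow hα ht hx hx0 k
  have hx1 : 0 < |x| := abs_pos.mpr hx0
  rw [abs_div, abs_pow, abs_of_nonneg (weight_nonneg hx), div_le_iff₀ (by positivity)]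
  refine h1.trans_eq ?_
  rw [mul_assoc, ← pow_add, ← two_mul, pow_mul, ← sq_abs, ← pow_mul]

@[fun_prop]
theorem measurable_weight (α t : ℝ) : Measurable (weight α t) := by
  unfold weight
  fun_prop

theorem ae_ne_zero_on (s : Set ℝ) : ∀ᵐ x : ℝ ∂(volume.restrict s), x ≠ 0 :=
  ae_restrict_of_ae (Measure.ae_ne volume 0)

theorem intervalIntegrable_laurent (hα : 0 < α) (ht : 0 < t) (k : ℕ) (p : ℝ[X]) :
    IntervalIntegrable (fun x => p.eval x * weight α t x / x ^ k) volume (-1) 1 := by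
  obtain ⟨M, hM⟩ := (isCompact_Icc (a := (-1 : ℝ)) (b := 1)).exists_bound_of_continuousOn
    (p.continuous.continuousOn)
  rw [intervalIntegrable_iff_integrableOn_Icc_of_le (by norm_num)]
  refine Measure.integrableOn_of_bounded (M := M * (k.factorial / t ^ k)) (by simp) ?_ ?_
  · have := p.continuous.measurable
    exact Measurable.aestronglyMeasurable (by fun_prop)
  · filter_upwards [ae_ne_zero_on (Icc (-1) 1), ae_restrict_mem measurableSet_Icc] with x hx0 hx
    rw [mul_div_assoc, norm_mul, Real.norm_eq_abs (_ / _)]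
    refine mul_le_mul (hM x hx) ((abs_weight_div_pow_le hα ht hx hx0 k).trans ?_) (abs_nonneg _)
      ((norm_nonneg _).trans (hM x hx))
    exact mul_le_of_le_one_right (by positivity) (pow_le_one₀ (abs_nonneg _) (abs_le.mpr hx))

end Weight

/-- The integrals `∫_{-1}^{1} p(x) w(x,t) x^{-k} dx` as a linear functional of the polynomial `p`. -/
def laurentInt {α t : ℝ} (hα : 0 < α) (ht : 0 < t) (k : ℕ) : ℝ[X] →ₗ[ℝ] ℝ where
  toFun p := ∫ x in (-1 : ℝ)..1, p.eval x * weight α t x / x ^ k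
  map_add' p q := by
    rw [← intervalIntegral.integral_add (intervalIntegrable_laurent hα ht k p)
      (intervalIntegrable_laurent hα ht k q)]
    congr 1; ext x; rw [eval_add]; ring
  map_smul' c p := by
    rw [RingHom.id_apply, smul_eq_mul, ← intervalIntegral.integral_const_mul]
    congr 1; ext x; rw [eval_smul, smul_eq_mul]; ring

/-! ### Calculus of the integrals `∫ p w x⁻ᵏ` -/

section LaurentInt

variable {α t : ℝ} (hα : 0 < α) (ht : 0 < t)

theorem laurentInt_apply (k : ℕ) (p : ℝ[X]) :
    laurentInt hα ht k p = ∫ x in (-1 : ℝ)..1, p.eval x * weight α t x / x ^ k := rfl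

theorem laurentInt_C_mul (k : ℕ) (c : ℝ) (p : ℝ[X]) :
    laurentInt hα ht k (C c * p) = c * laurentInt hα ht k p := by
  rw [← smul_eq_C_mul, map_smul, smul_eq_mul]

theorem innerW_eq_laurentInt (p q : ℝ[X]) : innerW α t p q = laurentInt hα ht 0 (p * q) := by
  simp [innerW, laurentInt_apply]

theorem laurentInt_congr_ae {k l : ℕ} {p q : ℝ[X]}
    (h : ∀ x : ℝ, x ≠ 0 → p.eval x / x ^ k = q.eval x / x ^ l) :
    laurentInt hα ht k p = laurentInt hα ht l q := by
  refine intervalIntegral.integral_congr_ae ?_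
  filter_upwards [Measure.ae_ne volume (0 : ℝ)] with x hx _
  rw [mul_div_right_comm, h x hx, mul_div_right_comm]

theorem laurentInt_succ_X_mul (k : ℕ) (p : ℝ[X]) :
    laurentInt hα ht (k + 1) (X * p) = laurentInt hα ht k p := by
  refine laurentInt_congr_ae hα ht fun x hx => ?_
  simp only [eval_mul, eval_X]
  field_simp
  ring

theorem laurentInt_mul_self_pos {k : ℕ} (hk : Even k) {p : ℝ[X]} (hp : p ≠ 0) :
    0 < laurentInt hα ht k (p * p) := by
  rw [laurentInt_apply, intervalIntegral.intervalIntegral_eq_integral_uIoc]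
  have h01 : (-1 : ℝ) ≤ 1 := by norm_num
  simp only [h01, if_true, one_smul, uIoc_of_le]
  rw [setIntegral_pos_iff_support_of_nonneg_ae]
  · have hsub : Ioo (-1 : ℝ) 1 \ ((insert 0 p.roots.toFinset : Finset ℝ) : Set ℝ) ⊆
        (Function.support fun x => (p * p).eval x * weight α t x / x ^ k) ∩ Ioc (-1) 1 := by
      intro x hx
      have hr : p.eval x ≠ 0 := by
        intro h
        exact hx.2 (by simp [hp, h])
      have hx0 : x ≠ 0 := by
        intro h
        exact hx.2 (by simp [h])
      refine ⟨?_, hx.1.1, hx.1.2.le⟩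
      simp [hr, (weight_pos (α := α) (t := t) hx.1).ne', hx0]
    refine lt_of_lt_of_le ?_ (measure_mono hsub)
    rw [measure_sdiff_null (Set.Finite.measure_zero (Finset.finite_toSet _) _)]
    simp
  · filter_upwards [ae_restrict_mem measurableSet_Ioc] with x hx
    have := weight_nonneg (α := α) (t := t) (Ioc_subset_Icc_self hx)
    rw [eval_mul]
    exact div_nonneg (mul_nonneg (mul_self_nonneg _) this) (hk.pow_nonneg x)
  · exact (intervalIntegrable_iff_integrableOn_Ioc_of_le h01).mp
      (intervalIntegrable_laurent hα ht k (p * p))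

theorem laurentInt_comp_neg (k : ℕ) (p : ℝ[X]) :
    laurentInt hα ht k (p.comp (-X)) = (-1) ^ k * laurentInt hα ht k p := by
  have h := intervalIntegral.integral_comp_neg (a := -1) (b := 1)
    (fun x => p.eval x * weight α t x / x ^ k)
  rw [neg_neg] at h
  rw [laurentInt_apply, laurentInt_apply, ← h, ← intervalIntegral.integral_const_mul]
  congr 1; ext x
  rw [weight_neg, eval_comp, eval_neg, eval_X, neg_pow x]
  have : ((-1 : ℝ) ^ k) * (-1) ^ k = 1 := by rw [← mul_pow]; simp
  rw [div_mul_eq_div_div, div_eq_mul_inv (_ * _) ((-1 : ℝ) ^ k), eq_inv_of_mul_eq_one_left this,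
    inv_inv]
  rw [eq_inv_of_mul_eq_one_left this]
  field_simp

theorem hasDerivAt_weight {x : ℝ} (hx : x ∈ Ioo (-1 : ℝ) 1) (hx0 : x ≠ 0) :
    HasDerivAt (weight α t)
      (-(2 * α * x / (1 - x ^ 2)) * weight α t x + 2 * t / x ^ 3 * weight α t x) x := by
  have hpos : 0 < 1 - x ^ 2 := by nlinarith [hx.1, hx.2]
  have h1 : HasDerivAt (fun y : ℝ => (1 - y ^ 2) ^ α)
      (-(2 * x) * α * (1 - x ^ 2) ^ (α - 1)) x := by
    have := ((hasDerivAt_pow 2 x).const_sub 1).rpow_const (p := α) (Or.inl hpos.ne')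
    convert this using 1
    norm_num
  have h2 : HasDerivAt (fun y : ℝ => Real.exp (-t / y ^ 2))
      (Real.exp (-t / x ^ 2) * (2 * t / x ^ 3)) x := by
    have := ((hasDerivAt_const x (-t)).div (hasDerivAt_pow 2 x) (pow_ne_zero 2 hx0)).exp
    convert this using 1
    simp only [Pi.div_apply, neg_div]
    congr 1
    field_simp
    norm_num [mul_comm]
  refine HasDerivAt.congr_deriv (h1.mul h2) ?_
  simp only [weight]
  rw [Real.rpow_sub_one hpos.ne']
  field_simp

/-- Integration by parts against the weight, i.e. the Pearson equation of `w`. -/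
theorem laurentInt_pearson (m : ℕ) (F : ℝ[X]) :
    laurentInt hα ht m (derivative F * (1 - X ^ 2)) - m * laurentInt hα ht (m + 1) (F * (1 - X ^ 2))
      - (2 + 2 * α) * laurentInt hα ht m (X * F) + 2 * t * laurentInt hα ht (m + 3) (F * (1 - X ^ 2))
      = 0 := by
  -- Away from `0` this is `F (1 - x²) w / x^m`. The spare factor `x` forces the value `0` at the
  -- origin; without it, for `m = 0`, the value `weight α t 0 = 1` would break continuity there.
  set Φ : ℝ → ℝ := fun x => (F.eval x * (x * (1 - x ^ 2))) * (weight α t x / x ^ (m + 1)) with hΦ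
  set Φ' : ℝ → ℝ := fun x =>
    ((derivative F * (1 - X ^ 2) : ℝ[X]).eval x * weight α t x / x ^ m
      - m * ((F * (1 - X ^ 2) : ℝ[X]).eval x * weight α t x / x ^ (m + 1))
      - (2 + 2 * α) * ((X * F : ℝ[X]).eval x * weight α t x / x ^ m))
      + 2 * t * ((F * (1 - X ^ 2) : ℝ[X]).eval x * weight α t x / x ^ (m + 3)) with hΦ'
  have i1 := intervalIntegrable_laurent hα ht m (derivative F * (1 - X ^ 2))
  have i2 := (intervalIntegrable_laurent hα ht (m + 1) (F * (1 - X ^ 2))).const_mul (m : ℝ)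
  have i3 := (intervalIntegrable_laurent hα ht m (X * F)).const_mul (2 + 2 * α)
  have i4 := (intervalIntegrable_laurent hα ht (m + 3) (F * (1 - X ^ 2))).const_mul (2 * t)
  have hint : IntervalIntegrable Φ' volume (-1) 1 := ((i1.sub i2).sub i3).add i4
  have key : ∫ x in (-1 : ℝ)..1, Φ' x = Φ 1 - Φ (-1) := by
    -- Only continuity is required at `±1`, where `(1 - x²)^α` need not be differentiable, and at
    -- the exceptional point `0`.
    refine integral_eq_of_hasDerivAt_off_countable_of_le Φ Φ' (by norm_num)
      (countable_singleton (0 : ℝ)) ?_ ?_ hint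
    · intro x hx
      by_cases hx0 : x = 0
      · subst hx0
        refine ContinuousAt.continuousWithinAt ?_
        have h0 : Φ 0 = 0 := by simp [Φ]
        change Tendsto Φ (𝓝 0) (𝓝 (Φ 0))
        rw [h0]
        have hg : Tendsto (fun x : ℝ => |F.eval x * (x * (1 - x ^ 2))| *
            ((m + 1).factorial / t ^ (m + 1) * |x| ^ (m + 1))) (𝓝 0) (𝓝 0) := by
          have hc : Continuous (fun x : ℝ => |F.eval x * (x * (1 - x ^ 2))| *
            ((m + 1).factorial / t ^ (m + 1) * |x| ^ (m + 1))) := by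
            have := F.continuous
            fun_prop
          simpa using hc.tendsto 0
        refine squeeze_zero_norm' ?_ hg
        filter_upwards [Icc_mem_nhds (show (-1 : ℝ) < 0 by norm_num) one_pos] with y hy
        by_cases hy0 : y = 0
        · subst hy0; simp [Φ]
        · change ‖(F.eval y * (y * (1 - y ^ 2))) * (weight α t y / y ^ (m + 1))‖ ≤ _
          rw [norm_mul]
          exact mul_le_mul_of_nonneg_left (abs_weight_div_pow_le hα ht hy hy0 _) (norm_nonneg _)
      · refine ContinuousAt.continuousWithinAt ?_
        have hw : ContinuousAt (weight α t) x := by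
          unfold weight
          refine ContinuousAt.mul ?_ ?_
          · exact (by fun_prop : ContinuousAt (fun y : ℝ => 1 - y ^ 2) x).rpow_const (Or.inr hα.le)
          · exact ContinuousAt.rexp (ContinuousAt.div (by fun_prop) (by fun_prop)
              (pow_ne_zero 2 hx0))
        have := F.continuous
        exact ContinuousAt.mul (by fun_prop)
          (hw.div (by fun_prop) (pow_ne_zero _ hx0))
    · rintro x ⟨hx, hx0⟩
      have hx0 : x ≠ 0 := hx0
      have hpos : 1 - x ^ 2 ≠ 0 := by nlinarith [hx.1, hx.2]
      have h1 : HasDerivAt (fun x : ℝ => x * (1 - x ^ 2)) (1 - 3 * x ^ 2) x := by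
        refine HasDerivAt.congr_deriv ((hasDerivAt_id x).mul ((hasDerivAt_pow 2 x).const_sub 1)) ?_
        simp; ring
      have h2 := (hasDerivAt_weight (α := α) (t := t) hx hx0).div (hasDerivAt_pow (m + 1) x)
        (pow_ne_zero _ hx0)
      refine HasDerivAt.congr_deriv (((F.hasDerivAt x).mul h1).mul h2) ?_
      simp only [Φ', eval_mul, eval_sub, eval_one, eval_pow, eval_X, Pi.mul_apply,
        Nat.add_sub_cancel]
      push_cast
      field_simp
      ring
  have hb : Φ 1 - Φ (-1) = 0 := by simp [hΦ]
  rw [hb] at key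
  rw [← key, hΦ', intervalIntegral.integral_add ((i1.sub i2).sub i3) i4,
    intervalIntegral.integral_sub (i1.sub i2) i3, intervalIntegral.integral_sub i1 i2]
  simp only [intervalIntegral.integral_const_mul, laurentInt_apply]

theorem hasDerivAt_laurentInt (k : ℕ) (p : ℝ[X]) :
    HasDerivAt (fun s => ∫ x in (-1 : ℝ)..1, p.eval x * weight α s x / x ^ k)
      (-laurentInt hα ht (k + 2) p) t := by
  have ht2 : 0 < t / 2 := by positivity
  have hp := p.continuous.measurable
  have key := (intervalIntegral.hasDerivAt_integral_of_dominated_loc_of_deriv_le (μ := volume)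
    (a := -1) (b := 1) (x₀ := t) (s := Ioi (t / 2))
    (F := fun s x => p.eval x * weight α s x / x ^ k)
    (F' := fun s x => -(p.eval x * weight α s x / x ^ (k + 2)))
    -- The weight decreases in its parameter, so its value at `t / 2` dominates on `s > t / 2`.
    (bound := fun x => |p.eval x * weight α (t / 2) x / x ^ (k + 2)|)
    (Ioi_mem_nhds (by linarith)) (Eventually.of_forall fun s => ?_)
    (intervalIntegrable_laurent hα ht k p) ?_ ?_
    (intervalIntegrable_laurent hα ht2 (k + 2) p).abs ?_).2
  · rwa [intervalIntegral.integral_neg] at key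
  · exact Measurable.aestronglyMeasurable (by fun_prop)
  · exact Measurable.aestronglyMeasurable (by fun_prop)
  · refine Eventually.of_forall fun x hx s hs => ?_
    rw [uIoc_of_le (by norm_num)] at hx
    have hx := Ioc_subset_Icc_self hx
    rw [norm_neg, Real.norm_eq_abs, abs_div, abs_div, abs_mul, abs_mul,
      abs_of_nonneg (weight_nonneg hx), abs_of_nonneg (weight_nonneg hx)]
    have := weight_anti (α := α) (le_of_lt hs) hx
    gcongr
  · filter_upwards [Measure.ae_ne volume (0 : ℝ)] with x hx0 _ s _
    have h1 : HasDerivAt (fun s : ℝ => Real.exp (-s / x ^ 2))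
        (Real.exp (-s / x ^ 2) * (-1 / x ^ 2)) s :=
      ((hasDerivAt_id s).neg.div_const (x ^ 2)).exp
    have h2 := ((h1.const_mul ((1 - x ^ 2) ^ α)).const_mul (p.eval x)).div_const (x ^ k)
    refine HasDerivAt.congr_deriv h2 ?_
    simp only [weight]
    field_simp
    ring

end LaurentInt

/-! ### Orthogonality, parity and the three term recurrence -/

section OrthPoly

theorem orthPoly_eq (α t : ℝ) (n : ℕ) : orthPoly α t n = X ^ n - ∑ j : Fin n,
    C (innerW α t (X ^ n) (orthPoly α t j) / innerW α t (orthPoly α t j) (orthPoly α t j)) *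
      orthPoly α t j := by
  rw [orthPoly]

theorem orthPoly_monic_natDegree (α t : ℝ) (n : ℕ) :
    (orthPoly α t n).Monic ∧ (orthPoly α t n).natDegree = n := by
  induction n using Nat.strong_induction_on with
  | _ n ih =>
    rw [orthPoly_eq]
    set S := ∑ j : Fin n, C (innerW α t (X ^ n) (orthPoly α t j) /
      innerW α t (orthPoly α t j) (orthPoly α t j)) * orthPoly α t j with hS
    have hdeg : S.degree < n := by
      rw [← mem_degreeLT]
      refine Submodule.sum_mem _ fun j _ => ?_
      rw [← smul_eq_C_mul]
      refine Submodule.smul_mem _ _ ?_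
      rw [mem_degreeLT, degree_eq_natDegree (ih j j.isLt).1.ne_zero, (ih j j.isLt).2]
      exact_mod_cast j.isLt
    have hdeg' : S.degree < (X ^ n : ℝ[X]).degree := by rwa [degree_X_pow]
    refine ⟨(monic_X_pow n).sub_of_left hdeg', natDegree_eq_of_degree_eq_some ?_⟩
    rw [degree_sub_eq_left_of_degree_lt hdeg', degree_X_pow]

theorem orthPoly_monic (α t : ℝ) (n : ℕ) : (orthPoly α t n).Monic :=
  (orthPoly_monic_natDegree α t n).1

theorem orthPoly_natDegree (α t : ℝ) (n : ℕ) : (orthPoly α t n).natDegree = n :=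
  (orthPoly_monic_natDegree α t n).2

theorem orthPoly_degree (α t : ℝ) (n : ℕ) : (orthPoly α t n).degree = n := by
  rw [degree_eq_natDegree (orthPoly_monic α t n).ne_zero, orthPoly_natDegree]

theorem orthPoly_coeff_self (α t : ℝ) (n : ℕ) : (orthPoly α t n).coeff n = 1 := by
  have := (orthPoly_monic α t n).coeff_natDegree
  rwa [orthPoly_natDegree] at this

theorem orthPoly_zero (α t : ℝ) : orthPoly α t 0 = 1 := by
  rw [orthPoly_eq]; simp

theorem degree_sub_lt_of_coeff_eq {p q : ℝ[X]} {n : ℕ} (hp : p.natDegree ≤ n)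
    (hq : q.natDegree ≤ n) (h : p.coeff n = q.coeff n) : (p - q).degree < n := by
  rw [degree_lt_iff_coeff_zero]
  intro m hm
  rcases hm.eq_or_lt with rfl | hm
  · rw [coeff_sub, h, sub_self]
  · rw [coeff_sub, coeff_eq_zero_of_natDegree_lt (hp.trans_lt hm),
      coeff_eq_zero_of_natDegree_lt (hq.trans_lt hm), sub_self]

variable {α t : ℝ} (hα : 0 < α) (ht : 0 < t)

theorem sqNorm_eq (n : ℕ) :
    sqNorm α n t = laurentInt hα ht 0 (orthPoly α t n * orthPoly α t n) :=
  innerW_eq_laurentInt hα ht _ _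

include hα ht in
theorem sqNorm_pos (n : ℕ) : 0 < sqNorm α n t := by
  rw [sqNorm_eq hα ht]
  exact laurentInt_mul_self_pos hα ht Even.zero (orthPoly_monic α t n).ne_zero

theorem laurentInt_orthPoly_mul_orthPoly (n : ℕ) :
    ∀ j < n, laurentInt hα ht 0 (orthPoly α t n * orthPoly α t j) = 0 := by
  induction n using Nat.strong_induction_on with
  | _ n ih =>
    intro j hj
    have hh : ∀ i < n, i ≠ j → laurentInt hα ht 0 (orthPoly α t i * orthPoly α t j) = 0 := by
      intro i hi hij
      rcases lt_or_gt_of_ne hij with h | h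
      · rw [mul_comm]; exact ih j hj i h
      · exact ih i hi j h
    have hpos := (sqNorm_pos hα ht j).ne'
    rw [sqNorm_eq hα ht] at hpos
    rw [orthPoly_eq α t n, sub_mul, map_sub, Finset.sum_mul, map_sum,
      Finset.sum_eq_single (⟨j, hj⟩ : Fin n)]
    · rw [mul_assoc, laurentInt_C_mul, innerW_eq_laurentInt hα ht, innerW_eq_laurentInt hα ht]
      simp only
      rw [div_mul_cancel₀ _ hpos, sub_self]
    · intro i _ hi
      rw [mul_assoc, laurentInt_C_mul, hh i i.isLt (fun h => hi (Fin.ext h)), mul_zero]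
    · simp

theorem laurentInt_mul_eq_zero_of_degree_lt (p : ℝ[X]) (N : ℕ)
    (h : ∀ j < N, laurentInt hα ht 0 (p * orthPoly α t j) = 0) :
    ∀ q : ℝ[X], q.degree < N → laurentInt hα ht 0 (p * q) = 0 := by
  induction N with
  | zero =>
    intro q hq
    have : q = 0 := by simpa [degree_lt_iff_coeff_zero, Polynomial.ext_iff] using hq
    simp [this]
  | succ N ih =>
    intro q hq
    have hqN : q.natDegree ≤ N := by
      rw [natDegree_le_iff_degree_le]
      exact Order.lt_succ_iff.mp hq
    have hr := degree_sub_lt_of_coeff_eq (q := C (q.coeff N) * orthPoly α t N) hqN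
      ((natDegree_C_mul_le _ _).trans (orthPoly_natDegree α t N).le)
      (by rw [coeff_C_mul, orthPoly_coeff_self, mul_one])
    have h1 := ih (fun j hj => h j (by omega)) _ hr
    have h2 := h N (by omega)
    have : p * q = p * (q - C (q.coeff N) * orthPoly α t N) + C (q.coeff N) * (p * orthPoly α t N) := by
      ring
    rw [this, map_add, h1, laurentInt_C_mul, h2, mul_zero, add_zero]

theorem laurentInt_orthPoly_mul {n : ℕ} {q : ℝ[X]} (hq : q.degree < n) :
    laurentInt hα ht 0 (orthPoly α t n * q) = 0 :=
  laurentInt_mul_eq_zero_of_degree_lt hα ht _ n (laurentInt_orthPoly_mul_orthPoly hα ht n) q hq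

theorem eq_zero_of_laurentInt_orthPoly_eq_zero {p : ℝ[X]} {N : ℕ} (hp : p.degree < N)
    (h : ∀ j < N, laurentInt hα ht 0 (p * orthPoly α t j) = 0) : p = 0 := by
  by_contra hne
  exact (laurentInt_mul_self_pos hα ht Even.zero hne).ne'
    (laurentInt_mul_eq_zero_of_degree_lt hα ht p N h p hp)

/-- Pairing with `P_n` reads off the top coefficient. -/
theorem laurentInt_orthPoly_mul_of_natDegree_le {n : ℕ} {q : ℝ[X]} (hq : q.natDegree ≤ n) :
    laurentInt hα ht 0 (orthPoly α t n * q) = q.coeff n * sqNorm α n t := by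
  have hr := degree_sub_lt_of_coeff_eq (q := C (q.coeff n) * orthPoly α t n) hq
    ((natDegree_C_mul_le _ _).trans (orthPoly_natDegree α t n).le)
    (by rw [coeff_C_mul, orthPoly_coeff_self, mul_one])
  have h1 := laurentInt_orthPoly_mul hα ht hr
  rw [mul_sub, map_sub, mul_left_comm, laurentInt_C_mul, ← sqNorm_eq] at h1
  linarith

/-- Expand `∫ (q - P_n)² w ≥ 0`. This extremal property lets `h_n` be differentiated without
differentiating `P_n` in `t`. -/
theorem sqNorm_le_of_monic {n : ℕ} {q : ℝ[X]} (hq : q.Monic) (hn : q.natDegree = n) :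
    sqNorm α n t ≤ laurentInt hα ht 0 (q * q) := by
  have hc : q.coeff n = 1 := by rw [← hn]; exact hq.coeff_natDegree
  have h1 := laurentInt_orthPoly_mul_of_natDegree_le hα ht hn.le
  have h2 : 0 ≤ laurentInt hα ht 0 ((q - orthPoly α t n) * (q - orthPoly α t n)) := by
    rcases eq_or_ne (q - orthPoly α t n) 0 with h | h
    · simp [h]
    · exact (laurentInt_mul_self_pos hα ht Even.zero h).le
  have h3 : (q - orthPoly α t n) * (q - orthPoly α t n) =
      q * q - orthPoly α t n * q - orthPoly α t n * q + orthPoly α t n * orthPoly α t n := by ring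
  rw [h3, map_add, map_sub, map_sub, h1, hc, ← sqNorm_eq] at h2
  linarith

theorem natDegree_comp_neg_X (p : ℝ[X]) : (p.comp (-X)).natDegree = p.natDegree := by
  rw [natDegree_comp, natDegree_neg, natDegree_X, mul_one]

include hα ht in
-- The weight is even, so the difference of the two sides, of degree below `n`, is orthogonal to
-- every `P_j` with `j < n`.
theorem orthPoly_comp_neg_X (n : ℕ) :
    (orthPoly α t n).comp (-X) = C ((-1) ^ n) * orthPoly α t n := by
  rw [← sub_eq_zero]
  refine eq_zero_of_laurentInt_orthPoly_eq_zero hα ht (N := n) ?_ ?_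
  · refine degree_sub_lt_of_coeff_eq ?_ ?_ ?_
    · rw [natDegree_comp_neg_X, orthPoly_natDegree]
    · exact (natDegree_C_mul_le _ _).trans (orthPoly_natDegree α t n).le
    · have h := comp_neg_X_leadingCoeff_eq (orthPoly α t n)
      rw [leadingCoeff, natDegree_comp_neg_X, orthPoly_natDegree, orthPoly_monic α t n] at h
      rw [coeff_C_mul, orthPoly_coeff_self, h]
  · intro j hj
    have h1 : (orthPoly α t n).comp (-X) * orthPoly α t j =
        (orthPoly α t n * (orthPoly α t j).comp (-X)).comp (-X) := by
      rw [mul_comp, comp_assoc]; simp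
    rw [sub_mul, map_sub, h1, laurentInt_comp_neg, mul_assoc (C _), laurentInt_C_mul,
      laurentInt_orthPoly_mul_orthPoly hα ht n j hj, laurentInt_orthPoly_mul]
    · simp
    · refine (degree_le_natDegree).trans_lt ?_
      rw [natDegree_comp_neg_X, orthPoly_natDegree]
      exact_mod_cast hj

include hα ht in
theorem orthPoly_one : orthPoly α t 1 = X := by
  have h := orthPoly_comp_neg_X hα ht 1
  have h0 := congrArg (eval 0) h
  rw [eval_comp, eval_neg, eval_X, neg_zero, eval_mul, eval_C, ← coeff_zero_eq_eval_zero] at h0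
  have h00 : (orthPoly α t 1).coeff 0 = 0 := by linarith
  rw [eq_X_add_C_of_natDegree_le_one (orthPoly_natDegree α t 1).le, orthPoly_coeff_self, h00]
  simp

include hα ht in
/-- The three term recurrence; there is no diagonal term because the weight is even. -/
theorem X_mul_orthPoly_succ (n : ℕ) : X * orthPoly α t (n + 1) =
    orthPoly α t (n + 2) + C (sqNorm α (n + 1) t / sqNorm α n t) * orthPoly α t n := by
  have hn := (sqNorm_pos hα ht n).ne'
  rw [← sub_eq_zero]
  refine eq_zero_of_laurentInt_orthPoly_eq_zero hα ht (N := n + 2) ?_ ?_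
  · rw [← sub_sub]
    have h1 : (X * orthPoly α t (n + 1) - orthPoly α t (n + 2)).degree < ((n + 2 : ℕ) : WithBot ℕ) := by
      refine degree_sub_lt_of_coeff_eq ?_ (orthPoly_natDegree _ _ _).le ?_
      · refine natDegree_mul_le.trans ?_
        rw [natDegree_X, orthPoly_natDegree]; omega
      · rw [coeff_X_mul, orthPoly_coeff_self, orthPoly_coeff_self]
    refine (degree_sub_le _ _).trans_lt (max_lt h1 ?_)
    refine degree_le_natDegree.trans_lt ?_
    refine (Nat.cast_le.mpr ((natDegree_C_mul_le _ _).trans (orthPoly_natDegree α t n).le)).trans_lt ?_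
    exact_mod_cast (by omega : n < n + 2)
  · intro j hj
    have e : (X * orthPoly α t (n + 1) - (orthPoly α t (n + 2) +
        C (sqNorm α (n + 1) t / sqNorm α n t) * orthPoly α t n)) * orthPoly α t j =
        orthPoly α t (n + 1) * (X * orthPoly α t j) - orthPoly α t (n + 2) * orthPoly α t j -
        C (sqNorm α (n + 1) t / sqNorm α n t) * (orthPoly α t n * orthPoly α t j) := by ring
    rw [e, map_sub, map_sub, laurentInt_orthPoly_mul_orthPoly hα ht (n + 2) j hj,
      laurentInt_C_mul, sub_zero]
    rcases (by omega : j < n ∨ j = n ∨ j = n + 1) with h | rfl | rfl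
    · rw [laurentInt_orthPoly_mul, laurentInt_orthPoly_mul_orthPoly hα ht n j h]
      · simp
      · rw [degree_mul, degree_X, orthPoly_degree]
        exact_mod_cast (by omega : 1 + j < n + 1)
    · rw [laurentInt_orthPoly_mul_of_natDegree_le, coeff_X_mul, orthPoly_coeff_self, ← sqNorm_eq]
      · field_simp; ring
      · refine natDegree_mul_le.trans ?_
        rw [natDegree_X, orthPoly_natDegree]; omega
    · rw [mul_comm (orthPoly α t n), laurentInt_orthPoly_mul_orthPoly hα ht _ n (by omega)]
      -- The diagonal coefficient is `∫ x P_{n+1}² w`, whose integrand is odd.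
      have h1 := laurentInt_comp_neg hα ht 0 (orthPoly α t (n + 1) * (X * orthPoly α t (n + 1)))
      have hs : ((-1 : ℝ) ^ (n + 1)) * (-1) ^ (n + 1) = 1 := by rw [← mul_pow]; simp
      have h2 : (orthPoly α t (n + 1) * (X * orthPoly α t (n + 1))).comp (-X) =
          C (-1) * (orthPoly α t (n + 1) * (X * orthPoly α t (n + 1))) := by
        rw [mul_comp, mul_comp, X_comp, orthPoly_comp_neg_X hα ht]
        have : (C ((-1 : ℝ) ^ (n + 1)) * C ((-1) ^ (n + 1)) : ℝ[X]) = 1 := by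
          rw [← C_mul, hs, C_1]
        simp only [C_neg, C_1]
        linear_combination (-(orthPoly α t (n + 1) * (X * orthPoly α t (n + 1)))) * this
      rw [h2, laurentInt_C_mul] at h1
      linarith

end OrthPoly

/-! ### Hankel determinants, their logarithmic derivative and `R_n` -/

section Hankel

variable {α t : ℝ} (hα : 0 < α) (ht : 0 < t)

theorem moment_eq (j : ℕ) : moment α j t = laurentInt hα ht 0 (X ^ j) := by
  simp [moment, laurentInt_apply]

theorem laurentInt_mul_eq_sum {n : ℕ} {p q : ℝ[X]} (hp : p.natDegree < n) (hq : q.natDegree < n) :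
    laurentInt hα ht 0 (p * q) =
      ∑ j : Fin n, ∑ k : Fin n, p.coeff j * moment α (j + k) t * q.coeff k := by
  conv_lhs => rw [p.as_sum_range_C_mul_X_pow' hp, q.as_sum_range_C_mul_X_pow' hq]
  rw [Finset.sum_range, Finset.sum_range, Finset.sum_mul_sum, map_sum]
  refine Finset.sum_congr rfl fun j _ => ?_
  rw [map_sum]
  refine Finset.sum_congr rfl fun k _ => ?_
  have : (C (p.coeff j) * X ^ (j : ℕ) * (C (q.coeff k) * X ^ (k : ℕ)) : ℝ[X]) =
      C (p.coeff j) * (C (q.coeff k) * X ^ ((j : ℕ) + k)) := by ring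
  rw [this, laurentInt_C_mul, laurentInt_C_mul, moment_eq hα ht]
  ring

include hα ht in
-- Passing from monomials to the `P_k` is a unitriangular change of basis that diagonalizes the Gram
-- matrix.
theorem hankelDet_eq_prod (n : ℕ) : hankelDet α n t = ∏ k ∈ Finset.range n, sqNorm α k t := by
  set A : Matrix (Fin n) (Fin n) ℝ := Matrix.of fun i j => (orthPoly α t i).coeff j with hA
  set H : Matrix (Fin n) (Fin n) ℝ := Matrix.of fun j k => moment α (j + k) t with hH
  have hdet : A.det = 1 := by
    rw [Matrix.det_of_isLowerTriangular A]
    · refine Finset.prod_eq_one fun i _ => ?_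
      exact orthPoly_coeff_self α t i
    · intro i j hij
      refine coeff_eq_zero_of_natDegree_lt ?_
      rw [orthPoly_natDegree]
      exact hij
  have hprod : A * H * A.transpose = Matrix.diagonal fun i : Fin n => sqNorm α i t := by
    ext i k
    have h1 : (A * H * A.transpose) i k =
        laurentInt hα ht 0 (orthPoly α t i * orthPoly α t k) := by
      rw [laurentInt_mul_eq_sum hα ht (n := n) (by rw [orthPoly_natDegree]; exact i.isLt)
        (by rw [orthPoly_natDegree]; exact k.isLt), Finset.sum_comm]
      simp only [Matrix.mul_apply, Matrix.transpose_apply, hA, hH, Matrix.of_apply, Finset.sum_mul]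
    rw [h1]
    rcases lt_trichotomy i k with h | rfl | h
    · rw [Matrix.diagonal_apply_ne _ h.ne, mul_comm]
      exact laurentInt_orthPoly_mul_orthPoly hα ht _ _ h
    · rw [Matrix.diagonal_apply_eq, sqNorm_eq hα ht]
    · rw [Matrix.diagonal_apply_ne _ h.ne']
      exact laurentInt_orthPoly_mul_orthPoly hα ht _ _ h
  have h2 := congrArg Matrix.det hprod
  rw [Matrix.det_mul, Matrix.det_mul, Matrix.det_transpose, hdet, Matrix.det_diagonal, one_mul,
    mul_one] at h2
  rw [Finset.prod_range]
  exact h2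

include hα ht in
theorem hankelDet_pos (n : ℕ) : 0 < hankelDet α n t := by
  rw [hankelDet_eq_prod hα ht]
  exact Finset.prod_pos fun k _ => sqNorm_pos hα ht k

include hα ht in
theorem differentiableAt_moment (j : ℕ) : DifferentiableAt ℝ (moment α j) t := by
  have h := (hasDerivAt_laurentInt hα ht 0 (X ^ j)).differentiableAt
  have e : (fun s => ∫ x in (-1 : ℝ)..1, (X ^ j : ℝ[X]).eval x * weight α s x / x ^ 0) =
      moment α j := by
    ext s; simp [moment]
  rwa [e] at h

include hα ht in
theorem differentiableAt_hankelDet (n : ℕ) : DifferentiableAt ℝ (hankelDet α n) t := by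
  have e : hankelDet α n = fun s => ∑ σ : Equiv.Perm (Fin n),
      Equiv.Perm.sign σ • ∏ i : Fin n, moment α ((σ i : ℕ) + i) s := by
    ext s
    rw [hankelDet, Matrix.det_apply]
    rfl
  rw [e]
  refine DifferentiableAt.fun_sum fun σ _ => ?_
  simp only [Units.smul_def, zsmul_eq_mul]
  refine DifferentiableAt.const_mul ?_ _
  exact DifferentiableAt.fun_finsetProd fun i _ => differentiableAt_moment hα ht _

include hα ht in
-- Near `t`, `h_n = D_{n+1} / D_n`, and the determinants are polynomials in the differentiable
-- moments.
theorem differentiableAt_sqNorm (n : ℕ) : DifferentiableAt ℝ (sqNorm α n) t := by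
  have h := (differentiableAt_hankelDet hα ht (n + 1)).div (differentiableAt_hankelDet hα ht n)
    (hankelDet_pos hα ht n).ne'
  refine h.congr_of_eventuallyEq ?_
  filter_upwards [lt_mem_nhds ht] with s hs
  rw [Pi.div_apply, eq_div_iff (hankelDet_pos hα hs n).ne', hankelDet_eq_prod hα hs,
    hankelDet_eq_prod hα hs, Finset.prod_range_succ, mul_comm]

/-- The derivative of `h_n` only sees the weight, since `h_n` is the minimum of `∫ q² w` over monic
polynomials `q` of degree `n`. -/
theorem hasDerivAt_sqNorm (n : ℕ) : HasDerivAt (sqNorm α n)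
    (-laurentInt hα ht 2 (orthPoly α t n * orthPoly α t n)) t := by
  have hd := (differentiableAt_sqNorm hα ht n).hasDerivAt
  set P := orthPoly α t n with hP
  have hf := hasDerivAt_laurentInt hα ht 0 (P * P)
  -- `P` is frozen at the parameter `t`. The difference is nonpositive near `t` and vanishes at `t`,
  -- so its derivative there is zero.
  have hmax : IsLocalMax (fun s => sqNorm α n s -
      ∫ x in (-1 : ℝ)..1, (P * P).eval x * weight α s x / x ^ 0) t := by
    filter_upwards [lt_mem_nhds ht] with s hs
    have h1 := sqNorm_le_of_monic hα hs (orthPoly_monic α t n) (orthPoly_natDegree α t n)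
    have h2 := sqNorm_eq hα ht n
    rw [laurentInt_apply] at h1 h2
    rw [← hP] at h1 h2
    linarith
  have h0 := hmax.hasDerivAt_eq_zero (hd.sub hf)
  rw [sub_eq_zero] at h0
  rwa [h0] at hd

theorem bigR_eq (n : ℕ) : bigR α n t =
    2 * t / sqNorm α n t * laurentInt hα ht 2 (orthPoly α t n * orthPoly α t n) := by
  simp only [bigR, laurentInt_apply, eval_mul, sq]

include hα ht in
theorem sigma_eq_neg_sum (n : ℕ) : sigma α n t = -∑ k ∈ Finset.range n, bigR α k t := by
  have h1 : HasDerivAt (fun s => ∑ k ∈ Finset.range n, Real.log (sqNorm α k s))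
      (∑ k ∈ Finset.range n,
        -laurentInt hα ht 2 (orthPoly α t k * orthPoly α t k) / sqNorm α k t) t :=
    HasDerivAt.fun_sum fun k _ => (hasDerivAt_sqNorm hα ht k).log (sqNorm_pos hα ht k).ne'
  have h2 : (fun s => Real.log (hankelDet α n s)) =ᶠ[𝓝 t]
      fun s => ∑ k ∈ Finset.range n, Real.log (sqNorm α k s) := by
    filter_upwards [lt_mem_nhds ht] with s hs
    rw [hankelDet_eq_prod hα hs, Real.log_prod fun k _ => (sqNorm_pos hα hs k).ne']
  rw [sigma, h2.deriv_eq, h1.deriv, Finset.mul_sum, ← Finset.sum_neg_distrib]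
  refine Finset.sum_congr rfl fun k _ => ?_
  rw [bigR_eq hα ht]
  ring

include hα ht in
theorem sigma_sub_sigma_succ (n : ℕ) : sigma α n t - sigma α (n + 1) t = bigR α n t := by
  rw [sigma_eq_neg_sum hα ht, sigma_eq_neg_sum hα ht, Finset.sum_range_succ]
  ring

include hα ht in
theorem bigR_pos (n : ℕ) : 0 < bigR α n t := by
  rw [bigR_eq hα ht]
  have h1 := sqNorm_pos hα ht n
  have h2 := laurentInt_mul_self_pos hα ht even_two (orthPoly_monic α t n).ne_zero
  positivity

end Hankel

/-! ### Ladder quantities, compatibility identities and the difference equation -/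

section Recurrence

/-- The polynomial `P_{n-1}`, with `P_{-1} = 0`. -/
def prevPoly (α t : ℝ) : ℕ → ℝ[X]
  | 0 => 0
  | n + 1 => orthPoly α t n

/-- The recurrence coefficient `β_n = h_n / h_{n-1}`, with `β_0 = 0`. -/
def recCoeff (α t : ℝ) : ℕ → ℝ
  | 0 => 0
  | n + 1 => sqNorm α (n + 1) t / sqNorm α n t

/-- The residue at the origin of the lowering coefficient of `P_n`. -/
def ladderC {α t : ℝ} (hα : 0 < α) (ht : 0 < t) (n : ℕ) : ℝ :=
  2 * t * recCoeff α t n / sqNorm α n t *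
    laurentInt hα ht 3 (orthPoly α t n * prevPoly α t n)

/-- The coefficient of `z⁻³` in the lowering coefficient of `P_n`. -/
def ladderR {α t : ℝ} (hα : 0 < α) (ht : 0 < t) (n : ℕ) : ℝ :=
  2 * t * recCoeff α t n / sqNorm α n t *
    laurentInt hα ht 1 (orthPoly α t n * prevPoly α t n)

/-- The normalized pairing of `x² P_n'` with `P_{n-1}`. -/
def derivPairing {α t : ℝ} (hα : 0 < α) (ht : 0 < t) (n : ℕ) : ℝ :=
  recCoeff α t n / sqNorm α n t *
    laurentInt hα ht 0 (X ^ 2 * derivative (orthPoly α t n) * prevPoly α t n)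

variable {α t : ℝ} (hα : 0 < α) (ht : 0 < t)

include hα ht

theorem X_mul_orthPoly (n : ℕ) : X * orthPoly α t n =
    orthPoly α t (n + 1) + C (recCoeff α t n) * prevPoly α t n := by
  cases n with
  | zero => simp [orthPoly_zero, orthPoly_one hα ht, recCoeff, prevPoly]
  | succ n => exact X_mul_orthPoly_succ hα ht n

/-- The ladder quantities are normalized by `β_n / h_n` so that they vanish at `n = 0`; for positive
index this converts the factor to `1 / h_{n-1}`. -/
theorem recCoeff_succ_div (n : ℕ) :
    recCoeff α t (n + 1) / sqNorm α (n + 1) t = 1 / sqNorm α n t := by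
  have h1 := (sqNorm_pos hα ht n).ne'
  have h2 := (sqNorm_pos hα ht (n + 1)).ne'
  simp only [recCoeff]
  field_simp

/-- Write `P_n² / x²` as `(x P_n) P_n / x³` and expand `x P_n` by the recurrence. -/
theorem ladderC_succ (n : ℕ) : ladderC hα ht (n + 1) = bigR α n t - ladderC hα ht n := by
  have h1 : laurentInt hα ht 3 (orthPoly α t (n + 1) * orthPoly α t n) =
      laurentInt hα ht 2 (orthPoly α t n * orthPoly α t n) -
        recCoeff α t n * laurentInt hα ht 3 (orthPoly α t n * prevPoly α t n) := by
    rw [← laurentInt_succ_X_mul hα ht 2, ← mul_assoc, X_mul_orthPoly hα ht, ← laurentInt_C_mul,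
      ← map_sub]
    congr 1; ring
  rw [ladderC, mul_div_assoc, recCoeff_succ_div hα ht, prevPoly, h1, bigR_eq hα ht, ladderC]
  ring

theorem ladderR_succ (n : ℕ) : ladderR hα ht (n + 1) = 2 * t - ladderR hα ht n := by
  have h1 : laurentInt hα ht 1 (orthPoly α t (n + 1) * orthPoly α t n) =
      sqNorm α n t - recCoeff α t n * laurentInt hα ht 1 (orthPoly α t n * prevPoly α t n) := by
    rw [sqNorm_eq hα ht, ← laurentInt_succ_X_mul hα ht 0, ← mul_assoc, X_mul_orthPoly hα ht,
      ← laurentInt_C_mul, ← map_sub]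
    congr 1; ring
  have h2 := (sqNorm_pos hα ht n).ne'
  rw [ladderR, mul_div_assoc, recCoeff_succ_div hα ht, prevPoly, h1, ladderR]
  field_simp

theorem ladderR_eq (n : ℕ) : ladderR hα ht n = t * (1 - (-1) ^ n) := by
  induction n with
  | zero => simp [ladderR, recCoeff]
  | succ n ih => rw [ladderR_succ, ih]; ring

/-- At `n = 0` the truncated index `n - 1` is harmless because `recCoeff α t 0 = 0`. -/
theorem recCoeff_mul_bigR_pred (n : ℕ) : recCoeff α t n * bigR α (n - 1) t =
    2 * t / sqNorm α n t * (recCoeff α t n ^ 2 *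
      laurentInt hα ht 2 (prevPoly α t n * prevPoly α t n)) := by
  cases n with
  | zero => simp [recCoeff]
  | succ n =>
    have h := recCoeff_succ_div hα ht n
    have h1 := (sqNorm_pos hα ht n).ne'
    simp only [Nat.add_sub_cancel, prevPoly, bigR_eq hα ht]
    linear_combination (-(2 * t * recCoeff α t (n + 1) *
      laurentInt hα ht 2 (orthPoly α t n * orthPoly α t n))) * h

/-- A difference of squares: `P_{n+1}² - β_n² P_{n-1}² = (P_{n+1} - β_n P_{n-1}) x P_n`. Dividing by
`x²` leaves the integrals of `ladderR`, which are known explicitly. -/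
theorem recCoeff_succ_mul_bigR_sub (n : ℕ) :
    recCoeff α t (n + 1) * bigR α (n + 1) t - recCoeff α t n * bigR α (n - 1) t =
      2 * t * (-1) ^ n := by
  have h1 : laurentInt hα ht 2 (orthPoly α t (n + 1) * orthPoly α t (n + 1)) -
      recCoeff α t n ^ 2 * laurentInt hα ht 2 (prevPoly α t n * prevPoly α t n) =
      laurentInt hα ht 1 (orthPoly α t (n + 1) * orthPoly α t n) -
        recCoeff α t n * laurentInt hα ht 1 (orthPoly α t n * prevPoly α t n) := by
    rw [← laurentInt_C_mul, ← laurentInt_C_mul, ← map_sub, ← map_sub,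
      ← laurentInt_succ_X_mul hα ht 1]
    congr 1
    rw [C_pow]
    linear_combination (C (recCoeff α t n) * prevPoly α t n - orthPoly α t (n + 1)) *
      X_mul_orthPoly hα ht n
  have h2 := recCoeff_succ_div hα ht n
  have h3 : ladderR hα ht (n + 1) = 2 * t / sqNorm α n t *
      laurentInt hα ht 1 (orthPoly α t (n + 1) * orthPoly α t n) := by
    rw [ladderR, mul_div_assoc, h2, prevPoly]; ring
  have h4 : ladderR hα ht (n + 1) - ladderR hα ht n = 2 * t * (-1) ^ n := by
    rw [ladderR_eq, ladderR_eq]; ring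
  rw [← h4, h3, ladderR, recCoeff_mul_bigR_pred hα ht, bigR_eq hα ht]
  linear_combination (2 * t / sqNorm α n t) * h1 + (2 * t *
    laurentInt hα ht 2 (orthPoly α t (n + 1) * orthPoly α t (n + 1))) * h2

omit hα ht in
theorem coeff_X_sq_mul_derivative (p : ℝ[X]) (m : ℕ) :
    (X ^ 2 * derivative p).coeff (m + 1) = m * p.coeff m := by
  rw [sq, mul_assoc, coeff_X_mul]
  cases m with
  | zero => simp
  | succ m => rw [coeff_X_mul, coeff_derivative]; push_cast; ring

theorem laurentInt_X_sq_mul_derivative (n : ℕ) :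
    laurentInt hα ht 0 (orthPoly α t (n + 1) * (X ^ 2 * derivative (orthPoly α t n))) =
      n * sqNorm α (n + 1) t := by
  rw [laurentInt_orthPoly_mul_of_natDegree_le, coeff_X_sq_mul_derivative, orthPoly_coeff_self,
    mul_one]
  cases n with
  | zero => simp [orthPoly_zero]
  | succ n =>
    refine natDegree_mul_le.trans ?_
    have := natDegree_derivative_le (orthPoly α t (n + 1))
    rw [orthPoly_natDegree] at this
    rw [natDegree_X_pow]; omega

/-- Differentiate the recurrence for `x P_n` and pair it with `x² P_n`. -/
theorem derivPairing_succ (n : ℕ) : derivPairing hα ht (n + 1) =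
    derivPairing hα ht n + (n + 1) * recCoeff α t (n + 1) - (n - 2) * recCoeff α t n := by
  have hh := (sqNorm_pos hα ht n).ne'
  have hd : derivative (orthPoly α t (n + 1)) = orthPoly α t n + X * derivative (orthPoly α t n) -
      C (recCoeff α t n) * derivative (prevPoly α t n) := by
    have h := congrArg derivative (X_mul_orthPoly hα ht n)
    simp only [derivative_mul, derivative_X, derivative_add, derivative_C] at h
    linear_combination -h
  have h1 : recCoeff α t n ^ 2 * laurentInt hα ht 0 (prevPoly α t n * prevPoly α t n) =
      recCoeff α t n * sqNorm α n t := by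
    cases n with
    | zero => simp [recCoeff]
    | succ n =>
      have := (sqNorm_pos hα ht n).ne'
      rw [prevPoly, ← sqNorm_eq, recCoeff]
      field_simp
  have h2 : recCoeff α t n * laurentInt hα ht 0 (orthPoly α t (n + 1) * prevPoly α t n) = 0 := by
    cases n with
    | zero => simp [recCoeff]
    | succ n =>
      rw [prevPoly, laurentInt_orthPoly_mul_orthPoly hα ht _ n (by omega), mul_zero]
  have h3 : recCoeff α t n *
      laurentInt hα ht 0 (orthPoly α t n * (X ^ 2 * derivative (prevPoly α t n))) =
      recCoeff α t n * ((n - 1) * sqNorm α n t) := by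
    cases n with
    | zero => simp [recCoeff]
    | succ n => rw [prevPoly, laurentInt_X_sq_mul_derivative]; push_cast; ring
  have h4 : recCoeff α t n *
      laurentInt hα ht 0 (X ^ 2 * derivative (orthPoly α t n) * prevPoly α t n) =
      sqNorm α n t * derivPairing hα ht n := by
    rw [derivPairing]; field_simp
  have h5 := laurentInt_X_sq_mul_derivative hα ht n
  have e : X ^ 2 * derivative (orthPoly α t (n + 1)) * orthPoly α t n =
      orthPoly α t (n + 1) * orthPoly α t (n + 1) +
      C (recCoeff α t n) * (orthPoly α t (n + 1) * prevPoly α t n) +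
      C (recCoeff α t n) * (orthPoly α t (n + 1) * prevPoly α t n) +
      C (recCoeff α t n ^ 2) * (prevPoly α t n * prevPoly α t n) +
      orthPoly α t (n + 1) * (X ^ 2 * derivative (orthPoly α t n)) +
      C (recCoeff α t n) * (X ^ 2 * derivative (orthPoly α t n) * prevPoly α t n) -
      C (recCoeff α t n) * (orthPoly α t n * (X ^ 2 * derivative (prevPoly α t n))) := by
    rw [hd, C_pow]
    linear_combination (X * orthPoly α t n + (orthPoly α t (n + 1) +
      C (recCoeff α t n) * prevPoly α t n) + X ^ 2 * derivative (orthPoly α t n)) *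
      X_mul_orthPoly hα ht n
  have hI := congrArg (laurentInt hα ht 0) e
  simp only [map_add, map_sub, laurentInt_C_mul, h1, h2, h3, h4, h5, ← sqNorm_eq] at hI
  rw [derivPairing, recCoeff_succ_div hα ht, prevPoly, hI]
  simp only [recCoeff]
  field_simp
  ring

/-- The Pearson equation tested on `P_n P_{n-1}`. -/
theorem derivPairing_eq (n : ℕ) : derivPairing hα ht n =
    n - (n + 1 + 2 * α) * recCoeff α t n + ladderC hα ht n - ladderR hα ht n := by
  cases n with
  | zero => simp [derivPairing, ladderC, ladderR, recCoeff]
  | succ m =>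
    have hm := (sqNorm_pos hα ht m).ne'
    have hp := laurentInt_pearson hα ht 0 (orthPoly α t (m + 1) * orthPoly α t m)
    have e1 : derivative (orthPoly α t (m + 1) * orthPoly α t m) * (1 - X ^ 2) =
        orthPoly α t m * derivative (orthPoly α t (m + 1)) +
        orthPoly α t (m + 1) * derivative (orthPoly α t m) -
        X ^ 2 * derivative (orthPoly α t (m + 1)) * orthPoly α t m -
        orthPoly α t (m + 1) * (X ^ 2 * derivative (orthPoly α t m)) := by
      rw [derivative_mul]; ring
    have e2 : orthPoly α t (m + 1) * orthPoly α t m * (1 - X ^ 2) =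
        orthPoly α t (m + 1) * orthPoly α t m -
          X * (X * (orthPoly α t (m + 1) * orthPoly α t m)) := by ring
    have h1 : laurentInt hα ht 0 (orthPoly α t m * derivative (orthPoly α t (m + 1))) =
        (m + 1) * sqNorm α m t := by
      have hd := natDegree_derivative_le (orthPoly α t (m + 1))
      rw [orthPoly_natDegree, Nat.add_sub_cancel] at hd
      rw [laurentInt_orthPoly_mul_of_natDegree_le hα ht hd, coeff_derivative, orthPoly_coeff_self]
      ring
    have h2 : laurentInt hα ht 0 (orthPoly α t (m + 1) * derivative (orthPoly α t m)) = 0 := by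
      refine laurentInt_orthPoly_mul hα ht ((degree_derivative_le).trans_lt ?_)
      rw [orthPoly_degree]
      exact_mod_cast Nat.lt_succ_self m
    have h3 : laurentInt hα ht 0 (X * (orthPoly α t (m + 1) * orthPoly α t m)) =
        sqNorm α (m + 1) t := by
      rw [mul_left_comm, laurentInt_orthPoly_mul_of_natDegree_le, coeff_X_mul, orthPoly_coeff_self,
        one_mul]
      refine natDegree_mul_le.trans ?_
      rw [natDegree_X, orthPoly_natDegree]; omega
    rw [e1, e2] at hp
    simp only [map_add, map_sub, laurentInt_succ_X_mul hα ht 2, laurentInt_succ_X_mul hα ht 1,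
      h1, h2, h3, laurentInt_X_sq_mul_derivative, Nat.cast_zero, zero_mul, zero_add] at hp
    have hc := recCoeff_succ_div hα ht m
    rw [derivPairing, ladderC, ladderR, mul_div_assoc, hc, prevPoly]
    simp only [recCoeff]
    push_cast
    field_simp
    linear_combination -hp

/-- Eliminates `derivPairing` between its recursion and its closed form from the Pearson equation.
-/
theorem recCoeff_succ_sub (n : ℕ) :
    recCoeff α t (n + 1) * (2 * n + 3 + 2 * α) - recCoeff α t n * (2 * n - 1 + 2 * α) =
      1 + ladderC hα ht (n + 1) - ladderC hα ht n - 2 * t * (-1) ^ n := by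
  have h := derivPairing_succ hα ht n
  rw [derivPairing_eq, derivPairing_eq, ladderR_eq, ladderR_eq] at h
  push_cast at h
  linear_combination -h

/-- The compatibility conditions of the ladder operators, by residues. -/
theorem compatibility (n : ℕ) :
    (ladderC hα ht n + n) * (ladderC hα ht n + n + 2 * α) =
      recCoeff α t n * (2 * n + 1 + 2 * α + bigR α n t) *
        (2 * n - 1 + 2 * α + bigR α (n - 1) t) ∧
    -2 * t * (-1) ^ n * ladderC hα ht n = recCoeff α t n * bigR α n t * bigR α (n - 1) t ∧
    ladderC hα ht n ^ 2 - 2 * t * (-1) ^ n * (ladderC hα ht n + n) + 2 * α * t * (1 - (-1) ^ n)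
        - sigma α n t =
      recCoeff α t n * ((2 * n + 1 + 2 * α + bigR α n t) * bigR α (n - 1) t +
        (2 * n - 1 + 2 * α + bigR α (n - 1) t) * bigR α n t) := by
  induction n with
  | zero => simp [ladderC, recCoeff, sigma_eq_neg_sum hα ht]
  | succ n ih =>
    obtain ⟨h1, h2, h3⟩ := ih
    have hc := ladderC_succ hα ht n
    have hR := recCoeff_succ_mul_bigR_sub hα ht n
    have hβ := recCoeff_succ_sub hα ht n
    have hσ := sigma_sub_sigma_succ hα ht n
    -- In each identity the increment from `n` to `n + 1` is evaluated by `hR` and `hβ`, the terms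
    -- `2t(-1)^n` cancelling in `hβ + hR`. On the left, `c_{n+1}² - c_n²` factors through `c_{n+1} +
    -- c_n = R_n`.
    have hR' : bigR α n t = ladderC hα ht (n + 1) + ladderC hα ht n := by linarith
    simp only [Nat.add_sub_cancel]
    push_cast
    rw [pow_succ]
    refine ⟨?_, ?_, ?_⟩
    · linear_combination h1 - (2 * n + 1 + 2 * α + bigR α n t) * (hβ + hR) -
        (1 + ladderC hα ht (n + 1) - ladderC hα ht n) * hR'
    · linear_combination h2 - bigR α n t * hR - 2 * t * (-1) ^ n * hR'
    · linear_combination h3 - (2 * n + 1 + 2 * α + bigR α n t) * hR - bigR α n t * (hβ + hR) + hσ -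
        (ladderC hα ht (n + 1) - ladderC hα ht n + 2 * t * (-1) ^ n) * hR'

/-- The second order difference equation satisfied by `σ_n`. -/
theorem sigma_difference_equation {n : ℕ} (hn : 1 ≤ n)
    (hodd : Odd n →
      (-1) ^ n * t * (2 * n + 1 + 2 * α) * (2 * n - 1 + 2 * α) +
        (n + α) * (sigma α (n - 1) t - sigma α n t) * (sigma α n t - sigma α (n + 1) t) ≠ 0) :
    (n - (sigma α (n - 1) t - sigma α n t) * (sigma α n t - sigma α (n + 1) t) *
          (2 * α * (n - t) + 2 * (-1) ^ n * t * (n + α) + n ^ 2 + sigma α n t) /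
        (2 * ((-1) ^ n * t * (2 * n + 1 + 2 * α) * (2 * n - 1 + 2 * α) +
          (n + α) * (sigma α (n - 1) t - sigma α n t) *
            (sigma α n t - sigma α (n + 1) t)))) *
      (n + 2 * α - (sigma α (n - 1) t - sigma α n t) * (sigma α n t - sigma α (n + 1) t) *
          (2 * α * (n - t) + 2 * (-1) ^ n * t * (n + α) + n ^ 2 + sigma α n t) /
        (2 * ((-1) ^ n * t * (2 * n + 1 + 2 * α) * (2 * n - 1 + 2 * α) +
          (n + α) * (sigma α (n - 1) t - sigma α n t) *
            (sigma α n t - sigma α (n + 1) t)))) =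
    t * (2 * n - 1 + 2 * α + sigma α (n - 1) t - sigma α n t) *
        (2 * n + 1 + 2 * α + sigma α n t - sigma α (n + 1) t) *
      ((2 * α * (n - t) + 2 * (-1) ^ n * t * (n + α) + n ^ 2 + sigma α n t) /
        (t * (2 * n + 1 + 2 * α) * (2 * n - 1 + 2 * α) +
          (-1) ^ n * (n + α) * (sigma α (n - 1) t - sigma α n t) *
            (sigma α n t - sigma α (n + 1) t))) := by
  obtain ⟨h1, h2, h3⟩ := compatibility hα ht n
  have hσ := sigma_sub_sigma_succ hα ht n
  have hσ' := sigma_sub_sigma_succ hα ht (n - 1)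
  rw [Nat.sub_add_cancel hn] at hσ'
  have hR := bigR_pos hα ht n
  have hR' := bigR_pos hα ht (n - 1)
  have hn' : (1 : ℝ) ≤ n := by exact_mod_cast hn
  have hε : ((-1 : ℝ) ^ n) * (-1) ^ n = 1 := by rw [← mul_pow]; simp
  have hΔ : (-1 : ℝ) ^ n * t * (2 * n + 1 + 2 * α) * (2 * n - 1 + 2 * α) +
      (n + α) * bigR α (n - 1) t * bigR α n t ≠ 0 := by
    -- For even `n` the quantity is a sum of positive terms, since `R_n` and `R_{n-1}` are positive.
    rcases Nat.even_or_odd n with he | ho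
    · rw [he.neg_one_pow]
      have : 0 < 2 * (n : ℝ) - 1 + 2 * α := by linarith
      positivity
    · have := hodd ho
      rwa [hσ, hσ'] at this
  rw [add_sub_assoc _ (sigma α (n - 1) t), add_sub_assoc _ (sigma α n t), hσ, hσ']
  generalize bigR α n t = R at *
  generalize bigR α (n - 1) t = R' at *
  generalize ladderC hα ht n = c at *
  generalize recCoeff α t n = b at *
  generalize sigma α n t = σ at *
  generalize (-1 : ℝ) ^ n = ε at *
  set Δ := ε * t * (2 * n + 1 + 2 * α) * (2 * n - 1 + 2 * α) + (n + α) * R' * R with hΔdef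
  have hden : t * (2 * n + 1 + 2 * α) * (2 * n - 1 + 2 * α) + ε * (n + α) * R' * R = ε * Δ := by
    rw [hΔdef]
    linear_combination (-(t * (2 * n + 1 + 2 * α) * (2 * n - 1 + 2 * α))) * hε
  set E := 2 * α * (n - t) + 2 * ε * t * (n + α) + n ^ 2 + σ with hE
  have hε0 : ε ≠ 0 := left_ne_zero_of_mul_eq_one hε
  -- In this combination of the three identities all terms with `R` cancel; `h2` then turns `c` into
  -- a multiple of `b`, which makes the equation linear in `b`.
  have hEc : E + 2 * c * (n + α) = b * (2 * n + 1 + 2 * α) * (2 * n - 1 + 2 * α) := by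
    rw [hE]
    linear_combination h1 - h3 + h2
  have hbE : t * E = b * (ε * Δ) := by
    rw [← hden]
    linear_combination t * hEc + ε * (n + α) * h2 + 2 * t * c * (n + α) * hε
  have hb : t * (E / (ε * Δ)) = b := by
    field_simp
    linear_combination hbE
  have hc : R' * R * E / (2 * Δ) = -c := by
    rw [div_eq_iff (by positivity)]
    apply mul_left_cancel₀ ht.ne'
    linear_combination R' * R * hbE - ε * Δ * h2 - 2 * t * c * Δ * hε
  rw [hden, hc]
  linear_combination h1 - (2 * n - 1 + 2 * α + R') * (2 * n + 1 + 2 * α + R) * hb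

end Recurrence

/-! ### Termwise differentiation -/

section PowerSeries

/-- Termwise differentiation of an everywhere absolutely convergent power series. -/
theorem hasDerivAt_tsum_mul_pow {c : ℕ → ℝ} (hc : ∀ r : ℝ, Summable fun k => c k * r ^ k) (z : ℝ) :
    HasDerivAt (fun z => ∑' k, c k * z ^ k) (∑' k : ℕ, (k + 1) * c (k + 1) * z ^ k) z := by
  set r := |z| + 1 with hr
  have hr0 : 0 < r := by positivity
  -- The radius is doubled so that the factor `k` produced by differentiation is absorbed by `k ≤
  -- 2ᵏ`.
  have hu : Summable fun k : ℕ => ‖c k * (2 * r) ^ k‖ := (hc (2 * r)).norm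
  have hb : ∀ (k : ℕ) (y : ℝ), y ∈ Metric.ball (0 : ℝ) r →
      ‖c k * (k * y ^ (k - 1))‖ ≤ ‖c k * (2 * r) ^ k‖ * r⁻¹ := by
    intro k y hy
    have hy' : |y| ≤ r := by simpa using (mem_ball_zero_iff.mp hy).le
    cases k with
    | zero => simp; positivity
    | succ k =>
      have h2 : ((k + 1 : ℕ) : ℝ) ≤ 2 ^ (k + 1) := by exact_mod_cast (Nat.lt_two_pow_self).le
      rw [norm_mul (c _), norm_mul (c _), mul_assoc]
      refine mul_le_mul_of_nonneg_left ?_ (norm_nonneg _)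
      rw [norm_mul, norm_pow, Real.norm_eq_abs y, Nat.add_sub_cancel, Real.norm_natCast, norm_pow,
        norm_mul, Real.norm_ofNat, Real.norm_of_nonneg hr0.le, mul_pow, pow_succ r, mul_assoc,
        mul_assoc, mul_inv_cancel₀ hr0.ne', mul_one]
      gcongr
  have key := hasDerivAt_tsum_of_isPreconnected (hu.mul_right r⁻¹) Metric.isOpen_ball
    (convex_ball (0 : ℝ) r).isPreconnected (g := fun k y => c k * y ^ k)
    (g' := fun k y => c k * (k * y ^ (k - 1)))
    (fun k y _ => (hasDerivAt_pow k y).const_mul (c k)) hb (Metric.mem_ball_self hr0) (hc 0)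
    (show z ∈ Metric.ball (0 : ℝ) r by simp [hr])
  refine key.congr_deriv ?_
  have hs : Summable fun k : ℕ => c k * (k * z ^ (k - 1)) :=
    Summable.of_norm_bounded (hu.mul_right r⁻¹) fun k => hb k z (by simp [hr])
  rw [hs.tsum_eq_zero_add]
  simp only [Nat.cast_zero, zero_mul, mul_zero, zero_add, Nat.add_sub_cancel]
  congr 1; ext k; push_cast; ring

end PowerSeries

/-! ### Derivative and contiguous relations of Kummer functions -/

section Kummer

/-- The coefficient of `z^k` in `Φ(a, b; z)`. -/
def kummerCoeff (a b : ℝ) (k : ℕ) : ℝ :=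
  (ascPochhammer ℝ k).eval a / (ascPochhammer ℝ k).eval b / (k.factorial : ℝ)

theorem kummer_eq (a b z : ℝ) : kummer a b z = ∑' k, kummerCoeff a b k * z ^ k := by
  simp only [kummer, kummerCoeff]
  congr 1; ext k; ring

theorem ascPochhammer_eval_succ_left (a : ℝ) (k : ℕ) :
    (ascPochhammer ℝ (k + 1)).eval a = a * (ascPochhammer ℝ k).eval (a + 1) := by
  rw [ascPochhammer_succ_left, eval_mul, eval_X, eval_comp]; simp

theorem ascPochhammer_eval_add_one (a : ℝ) (k : ℕ) :
    a * (ascPochhammer ℝ k).eval (a + 1) = (ascPochhammer ℝ k).eval a * (a + k) := by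
  rw [← ascPochhammer_eval_succ_left, ascPochhammer_succ_eval]

theorem ascPochhammer_eval_ne_zero {b : ℝ} (hb : ∀ k : ℕ, b + k ≠ 0) (k : ℕ) :
    (ascPochhammer ℝ k).eval b ≠ 0 := by
  induction k with
  | zero => simp
  | succ k ih => rw [ascPochhammer_succ_eval]; exact mul_ne_zero ih (hb k)

theorem add_one_add_natCast_ne_zero {b : ℝ} (hb : ∀ k : ℕ, b + k ≠ 0) (k : ℕ) : b + 1 + k ≠ 0 := by
  have := hb (k + 1)
  push_cast at this
  rwa [add_assoc, add_comm (1 : ℝ)]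

theorem kummerCoeff_zero (a b : ℝ) : kummerCoeff a b 0 = 1 := by simp [kummerCoeff]

theorem kummerCoeff_succ (a b : ℝ) (k : ℕ) :
    kummerCoeff a b (k + 1) = (a + k) / ((b + k) * (k + 1)) * kummerCoeff a b k := by
  simp only [kummerCoeff, ascPochhammer_succ_eval, Nat.factorial_succ]
  push_cast
  rw [mul_comm _ (a + (k : ℝ)), mul_comm _ (b + (k : ℝ))]
  simp only [div_eq_mul_inv, mul_inv]
  ring

theorem summable_kummerCoeff (a b z : ℝ) : Summable fun k => kummerCoeff a b k * z ^ k := by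
  have h1 : Tendsto (fun k : ℕ => (a + k) / (b + k)) atTop (𝓝 1) := by
    have h := tendsto_natCast_atTop_atTop (R := ℝ)
    have h2 : Tendsto (fun k : ℕ => 1 + (a - b) / (b + k)) atTop (𝓝 (1 + 0)) :=
      tendsto_const_nhds.add ((tendsto_const_nhds).div_atTop (tendsto_atTop_add_const_left _ b h))
    rw [add_zero] at h2
    refine h2.congr' ?_
    filter_upwards [(tendsto_atTop_add_const_left _ b h).eventually_gt_atTop 0] with k hk
    field_simp
    ring
  have h2 : Tendsto (fun k : ℕ => z * (1 / ((k : ℝ) + 1))) atTop (𝓝 (z * 0)) :=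
    tendsto_one_div_add_atTop_nhds_zero_nat.const_mul z
  have h3 := (h1.mul h2).norm
  rw [mul_zero, mul_zero, norm_zero] at h3
  refine summable_of_ratio_norm_eventually_le (r := 1 / 2) (by norm_num) ?_
  filter_upwards [h3.eventually_lt_const (show (0 : ℝ) < 1 / 2 by norm_num)] with k hk
  have e : kummerCoeff a b (k + 1) * z ^ (k + 1) =
      (a + k) / (b + k) * (z * (1 / ((k : ℝ) + 1))) * (kummerCoeff a b k * z ^ k) := by
    rw [kummerCoeff_succ, pow_succ]
    simp only [div_eq_mul_inv, mul_inv]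
    ring
  rw [e, norm_mul]
  exact mul_le_mul_of_nonneg_right hk.le (norm_nonneg _)

theorem kummer_zero (a b : ℝ) : kummer a b 0 = 1 := by
  rw [kummer_eq, tsum_eq_single 0 (fun k hk => by simp [hk])]
  simp [kummerCoeff_zero]

variable {b : ℝ} (hb : ∀ k : ℕ, b + k ≠ 0)

include hb

theorem hasDerivAt_kummer (a z : ℝ) :
    HasDerivAt (kummer a b) (a / b * kummer (a + 1) (b + 1) z) z := by
  have h := hasDerivAt_tsum_mul_pow (summable_kummerCoeff a b) z
  have e : (fun z => ∑' k, kummerCoeff a b k * z ^ k) = kummer a b := by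
    ext z; rw [kummer_eq]
  rw [e] at h
  convert h using 1
  rw [kummer_eq, ← tsum_mul_left]
  congr 1; ext k
  have h0 : b ≠ 0 := by simpa using hb 0
  have h1 := ascPochhammer_eval_ne_zero (add_one_add_natCast_ne_zero hb) k
  simp only [kummerCoeff, ascPochhammer_eval_succ_left, Nat.factorial_succ]
  push_cast
  field_simp

/-- The constant terms cancel, so a factor `z` comes out after an index shift. -/
theorem kummer_add_one_left_sub (a z : ℝ) :
    kummer (a + 1) b z - kummer a b z = z / b * kummer (a + 1) (b + 1) z := by
  have s1 := summable_kummerCoeff (a + 1) b z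
  have s2 := summable_kummerCoeff a b z
  rw [kummer_eq, kummer_eq, kummer_eq, s1.tsum_eq_zero_add, s2.tsum_eq_zero_add,
    kummerCoeff_zero, kummerCoeff_zero, add_sub_add_left_eq_sub,
    ← ((summable_nat_add_iff 1).mpr s1).tsum_sub ((summable_nat_add_iff 1).mpr s2),
    ← tsum_mul_left]
  congr 1; ext k
  have h0 : b ≠ 0 := by simpa using hb 0
  have h1 := ascPochhammer_eval_ne_zero (add_one_add_natCast_ne_zero hb) k
  have h2 : (ascPochhammer ℝ (k + 1)).eval (a + 1) =
      (ascPochhammer ℝ k).eval (a + 1) * (a + 1 + k) := ascPochhammer_succ_eval _ _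
  simp only [kummerCoeff, h2, ascPochhammer_eval_succ_left, Nat.factorial_succ]
  push_cast
  field_simp
  ring

theorem mul_kummer_add_one_add_one (a z : ℝ) :
    a * kummer (a + 1) (b + 1) z = b * kummer a b z + (a - b) * kummer a (b + 1) z := by
  have s1 := (summable_kummerCoeff a b z).mul_left b
  have s2 := (summable_kummerCoeff a (b + 1) z).mul_left (a - b)
  rw [kummer_eq, kummer_eq, kummer_eq, ← tsum_mul_left, ← tsum_mul_left, ← tsum_mul_left,
    ← s1.tsum_add s2]
  congr 1; ext k
  have h0 : b ≠ 0 := by simpa using hb 0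
  have h1 := ascPochhammer_eval_ne_zero (add_one_add_natCast_ne_zero hb) k
  have h2 := ascPochhammer_eval_ne_zero hb k
  have h3 := ascPochhammer_eval_add_one a k
  have h4 := ascPochhammer_eval_add_one b k
  simp only [kummerCoeff]
  field_simp
  linear_combination z ^ k * (ascPochhammer ℝ k).eval b * h3 - z ^ k * (ascPochhammer ℝ k).eval a * h4

end Kummer

/-! ### Half-integer parameters and the substitution `z = -s²` -/

section HalfIntegers

theorem half_add_natCast_ne_zero (k : ℕ) : (1 / 2 : ℝ) + k ≠ 0 := by positivity

theorem three_halves_add_natCast_ne_zero (k : ℕ) : (3 / 2 : ℝ) + k ≠ 0 := by positivity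

theorem neg_half_add_natCast_ne_zero (k : ℕ) : (-(1 / 2) : ℝ) + k ≠ 0 := by
  intro h
  have h1 : (2 * k : ℝ) = 1 := by linarith
  have h2 : 2 * k = 1 := by exact_mod_cast h1
  omega

/-- This and `kummer_five_halves` bring the denominator of `R_1` back to the lower parameters `1/2`
and `3/2` that occur in the moments. -/
theorem kummer_neg_half (a z : ℝ) : kummer a (-(1 / 2)) z =
    (1 + 2 * z) * kummer (a + 1) (1 / 2) z - 4 * z * (a + 1) * kummer (a + 2) (3 / 2) z := by
  have h1 := kummer_add_one_left_sub neg_half_add_natCast_ne_zero a z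
  have h2 := mul_kummer_add_one_add_one neg_half_add_natCast_ne_zero (a + 1) z
  have h3 := kummer_add_one_left_sub half_add_natCast_ne_zero (a + 1) z
  rw [show (-(1 / 2) : ℝ) + 1 = 1 / 2 by norm_num] at h1 h2
  rw [show (1 / 2 : ℝ) + 1 = 3 / 2 by norm_num] at h3
  rw [show a + 1 + 1 = a + 2 by ring] at h2 h3
  linear_combination -h1 + 2 * h2 - 2 * (a + 1) * h3

theorem kummer_five_halves (a z : ℝ) : 4 / 3 * z * (3 / 2 - a) * kummer a (5 / 2) z =
    (1 + 2 * z) * kummer a (3 / 2) z - kummer a (1 / 2) z := by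
  have h1 := mul_kummer_add_one_add_one half_add_natCast_ne_zero a z
  have h2 := kummer_add_one_left_sub three_halves_add_natCast_ne_zero a z
  have h3 := mul_kummer_add_one_add_one three_halves_add_natCast_ne_zero a z
  rw [show (1 / 2 : ℝ) + 1 = 3 / 2 by norm_num] at h1
  rw [show (3 / 2 : ℝ) + 1 = 5 / 2 by norm_num] at h2 h3
  linear_combination -2 * h1 + 2 * a * h2 + 4 / 3 * z * h3

theorem hasDerivAt_kummer_neg_sq {b : ℝ} (hb : ∀ k : ℕ, b + k ≠ 0) (a s : ℝ) :
    HasDerivAt (fun s => kummer a b (-s ^ 2))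
      (-(2 * s) * (a / b * kummer (a + 1) (b + 1) (-s ^ 2))) s := by
  have h := (hasDerivAt_kummer hb a (-s ^ 2)).comp s (hasDerivAt_pow 2 s).neg
  refine h.congr_deriv ?_
  norm_num
  ring

/-- On coefficients this is `(3/2)_k = (2k + 1) (1/2)_k`. -/
theorem hasDerivAt_mul_kummer_neg_sq (a s : ℝ) :
    HasDerivAt (fun s => s * kummer a (3 / 2) (-s ^ 2)) (kummer a (1 / 2) (-s ^ 2)) s := by
  have h := (hasDerivAt_id s).mul (hasDerivAt_kummer_neg_sq three_halves_add_natCast_ne_zero a s)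
  refine h.congr_deriv ?_
  have h1 := mul_kummer_add_one_add_one half_add_natCast_ne_zero a (-s ^ 2)
  have h2 := kummer_add_one_left_sub three_halves_add_natCast_ne_zero a (-s ^ 2)
  rw [show (1 / 2 : ℝ) + 1 = 3 / 2 by norm_num] at h1
  simp only [id]
  linear_combination 2 * h1 - 2 * a * h2

end HalfIntegers

/-! ### Uniqueness for the linear system -/

section Uniqueness

/-- Uniqueness for the linear system `u' = -2v`, `v' = -2sv - κu` on `(0, ∞)` with zero initial
values. -/
theorem linear_system_eq_zero {u v : ℝ → ℝ} {κ : ℝ}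
    (hu : ∀ s, 0 < s → HasDerivAt u (-2 * v s) s)
    (hv : ∀ s, 0 < s → HasDerivAt v (-2 * s * v s - κ * u s) s)
    (hu0 : Tendsto u (𝓝[>] 0) (𝓝 0)) (hv0 : Tendsto v (𝓝[>] 0) (𝓝 0)) {s : ℝ} (hs : 0 < s) :
    u s = 0 ∧ v s = 0 := by
  -- In the derivative of `u² + v²` the terms `-4uv` and `-2κuv` are at most `2` and `|κ|` times `u²
  -- + v²`, and `-4sv²` has the right sign.
  set K := 2 + |κ| with hK
  set φ : ℝ → ℝ := fun s => Real.exp (-K * s) * (u s ^ 2 + v s ^ 2) with hφ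
  have hd : ∀ s, 0 < s → HasDerivAt φ (Real.exp (-K * s) *
      (-K * (u s ^ 2 + v s ^ 2) - 4 * u s * v s - 4 * s * v s ^ 2 - 2 * κ * u s * v s)) s := by
    intro s hs
    have he : HasDerivAt (fun s : ℝ => Real.exp (-K * s)) (Real.exp (-K * s) * (-K * 1)) s :=
      ((hasDerivAt_id s).const_mul (-K)).exp
    refine (he.mul (((hu s hs).pow 2).add ((hv s hs).pow 2))).congr_deriv ?_
    simp only [Pi.add_apply, Pi.pow_apply]
    norm_num
    ring
  have hanti : AntitoneOn φ (Ioi 0) := by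
    refine antitoneOn_of_deriv_nonpos (convex_Ioi 0)
      (fun x hx => (hd x hx).continuousAt.continuousWithinAt)
      (fun x hx => (hd x (interior_subset hx)).differentiableAt.differentiableWithinAt) ?_
    intro x hx
    have hx : 0 < x := interior_subset hx
    rw [(hd x hx).deriv]
    refine mul_nonpos_of_nonneg_of_nonpos (Real.exp_pos _).le ?_
    have h1 : -(4 * u x * v x) ≤ 2 * (u x ^ 2 + v x ^ 2) := by nlinarith [sq_nonneg (u x + v x)]
    have h2 : -(2 * κ * u x * v x) ≤ |κ| * (u x ^ 2 + v x ^ 2) := by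
      have h3 : |2 * u x * v x| ≤ u x ^ 2 + v x ^ 2 := by
        rw [abs_le]
        constructor <;> nlinarith [sq_nonneg (u x + v x), sq_nonneg (u x - v x)]
      calc -(2 * κ * u x * v x) ≤ |-(2 * κ * u x * v x)| := le_abs_self _
        _ = |κ| * |2 * u x * v x| := by rw [abs_neg, ← abs_mul]; congr 1; ring
        _ ≤ _ := mul_le_mul_of_nonneg_left h3 (abs_nonneg _)
    have h3 : 0 ≤ 4 * x * v x ^ 2 := by positivity
    rw [hK]
    linarith
  have hlim : Tendsto φ (𝓝[>] 0) (𝓝 0) := by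
    have h1 : Tendsto (fun s : ℝ => Real.exp (-K * s)) (𝓝[>] 0) (𝓝 (Real.exp (-K * 0))) :=
      ((by fun_prop : Continuous fun s : ℝ => Real.exp (-K * s)).tendsto 0).mono_left
        nhdsWithin_le_nhds
    have h2 := h1.mul ((hu0.pow 2).add (hv0.pow 2))
    norm_num at h2
    simpa [φ] using h2
  have hle : φ s ≤ 0 := by
    refine ge_of_tendsto hlim ?_
    filter_upwards [Ioo_mem_nhdsGT hs] with r hr
    exact hanti hr.1 hs hr.2.le
  have hsum : u s ^ 2 + v s ^ 2 ≤ 0 := by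
    by_contra! h
    exact absurd hle (not_le.mpr (mul_pos (Real.exp_pos _) h))
  constructor <;> nlinarith [sq_nonneg (u s), sq_nonneg (v s)]

end Uniqueness

/-! ### Limits at `s = 0`, moments as Kummer functions, and `R_0`, `R_1` -/

section InitialValues

theorem integral_rpow_mul_one_sub_rpow {a b : ℝ} (ha : 0 < a) (hb : 0 < b) :
    ∫ x in (0 : ℝ)..1, x ^ (a - 1) * (1 - x) ^ (b - 1) =
      Real.Gamma a * Real.Gamma b / Real.Gamma (a + b) := by
  change _ = ProbabilityTheory.beta a b
  have h : ((∫ x in (0 : ℝ)..1, x ^ (a - 1) * (1 - x) ^ (b - 1) : ℝ) : ℂ) =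
      Complex.betaIntegral a b := by
    rw [Complex.betaIntegral, ← intervalIntegral.integral_ofReal]
    refine intervalIntegral.integral_congr fun x hx => ?_
    rw [uIcc_of_le zero_le_one] at hx
    rw [Complex.ofReal_mul, Complex.ofReal_cpow hx.1, Complex.ofReal_cpow (by linarith [hx.2])]
    push_cast
    rfl
  rw [ProbabilityTheory.beta_eq_betaIntegralReal a b ha hb, ← h, Complex.ofReal_re]

/-- The substitution `x ↦ 2x - 1` gives `2 · 4^α B(α + 1, α + 1)`; the duplication formula for `Γ`
simplifies it. -/
theorem integral_one_sub_sq_rpow {α : ℝ} (hα : 0 < α) :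
    ∫ x in (-1 : ℝ)..1, (1 - x ^ 2) ^ α =
      √Real.pi * Real.Gamma (1 + α) / Real.Gamma (3 / 2 + α) := by
  have h1 := intervalIntegral.integral_comp_mul_sub (a := 0) (b := 1)
    (fun x : ℝ => (1 - x ^ 2) ^ α) (two_ne_zero' ℝ) 1
  norm_num at h1
  have h2 : ∫ x in (0 : ℝ)..1, (1 - (2 * x - 1) ^ 2) ^ α =
      4 ^ α * ∫ x in (0 : ℝ)..1, x ^ (α + 1 - 1) * (1 - x) ^ (α + 1 - 1) := by
    rw [← intervalIntegral.integral_const_mul]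
    refine intervalIntegral.integral_congr fun x hx => ?_
    rw [uIcc_of_le zero_le_one] at hx
    simp only [add_sub_cancel_right]
    rw [← Real.mul_rpow hx.1 (by linarith [hx.2]),
      ← Real.mul_rpow (by norm_num) (mul_nonneg hx.1 (by linarith [hx.2]))]
    congr 1; ring
  have hp : 0 < α + 1 := by linarith
  rw [integral_rpow_mul_one_sub_rpow hp hp] at h2
  have h3 := Real.Gamma_mul_Gamma_add_half_of_pos hp
  have e1 : α + 1 + 1 / 2 = 3 / 2 + α := by ring
  have e2 : 1 - 2 * (α + 1) = -(2 * α + 1) := by ring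
  have e3 : (2 : ℝ) ^ (-(2 * α + 1)) = (4 ^ α * 2)⁻¹ := by
    rw [Real.rpow_neg (by norm_num), Real.rpow_add (by norm_num), Real.rpow_mul (by norm_num)]
    norm_num
  rw [e1, e2, e3] at h3
  have hG1 : 0 < Real.Gamma (α + 1) := Real.Gamma_pos_of_pos hp
  have hG2 : 0 < Real.Gamma (3 / 2 + α) := Real.Gamma_pos_of_pos (by linarith)
  have hG3 : 0 < Real.Gamma (α + 1 + (α + 1)) := Real.Gamma_pos_of_pos (by linarith)
  have h4 : (0 : ℝ) < 4 ^ α := by positivity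
  rw [two_mul (α + 1)] at h3
  have h5 : ∫ x in (-1 : ℝ)..1, (1 - x ^ 2) ^ α = 2 * ∫ x in (0 : ℝ)..1, (1 - (2 * x - 1) ^ 2) ^ α := by
    rw [h1]; ring
  rw [h5, h2, add_comm 1 α, eq_div_iff hG2.ne']
  field_simp at h3 ⊢
  linear_combination h3

theorem exp_neg_inv_sq_div_le (y : ℝ) : Real.exp (-1 / y ^ 2) / y ^ 2 ≤ (1 + y ^ 2)⁻¹ := by
  rcases eq_or_ne y 0 with rfl | hy
  · simp
  · have hy2 : 0 < y ^ 2 := by positivity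
    have h := Real.add_one_le_exp (1 / y ^ 2)
    rw [neg_div, Real.exp_neg, inv_div_left]
    refine inv_anti₀ (by positivity) ?_
    calc 1 + y ^ 2 = y ^ 2 * (1 / y ^ 2 + 1) := by field_simp
      _ ≤ _ := by gcongr

/-- The inversion `y ↦ 1 / y` turns this into the Gaussian integral. -/
theorem integral_exp_neg_inv_sq_div : ∫ y : ℝ, Real.exp (-1 / y ^ 2) / y ^ 2 = √Real.pi := by
  have h1 := integral_comp_abs (f := fun y => Real.exp (-1 / y ^ 2) / y ^ 2)
  simp only [sq_abs] at h1
  have h2 := integral_comp_rpow_Ioi (fun v : ℝ => Real.exp (-1 * v ^ 2)) (p := -1) (by norm_num)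
  have h3 := integral_gaussian_Ioi 1
  rw [h3] at h2
  rw [h1]
  have h4 : ∫ y in Ioi (0 : ℝ), Real.exp (-1 / y ^ 2) / y ^ 2 = √(Real.pi / 1) / 2 := by
    rw [← h2]
    refine setIntegral_congr_fun measurableSet_Ioi fun y hy => ?_
    have hy : (0 : ℝ) < y := hy
    simp only [smul_eq_mul]
    rw [Real.rpow_neg_one, show (-1 : ℝ) - 1 = -(2 : ℕ) by norm_num, Real.rpow_neg hy.le,
      Real.rpow_natCast, abs_neg, abs_one, one_mul, inv_pow, ← div_eq_mul_inv,
      div_eq_mul_inv _ (y ^ 2), mul_comm]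
  rw [h4, div_one]
  ring

variable {α : ℝ} (hα : 0 < α)

include hα

/-- Dominated convergence with majorant `1`; the limit is the unperturbed zeroth moment. -/
theorem tendsto_integral_weight_sq :
    Tendsto (fun s : ℝ => ∫ x in (-1 : ℝ)..1, (1 : ℝ[X]).eval x * weight α (s ^ 2) x / x ^ 0)
      (𝓝[>] 0) (𝓝 (√Real.pi * Real.Gamma (1 + α) / Real.Gamma (3 / 2 + α))) := by
  rw [← integral_one_sub_sq_rpow hα]
  simp only [eval_one, one_mul, pow_zero, div_one]
  refine intervalIntegral.tendsto_integral_filter_of_dominated_convergence (fun _ => 1) ?_ ?_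
    intervalIntegrable_const ?_
  · exact Eventually.of_forall fun s => (measurable_weight α (s ^ 2)).aestronglyMeasurable
  · refine Eventually.of_forall fun s => Eventually.of_forall fun x hx => ?_
    rw [uIoc_of_le (by norm_num)] at hx
    have hx := Ioc_subset_Icc_self hx
    rw [Real.norm_of_nonneg (weight_nonneg hx)]
    refine (weight_le_exp hα hx).trans ?_
    rw [Real.exp_le_one_iff, neg_div, neg_nonpos]
    positivity
  · refine Eventually.of_forall fun x _ => ?_
    have hc : Continuous fun s : ℝ => weight α (s ^ 2) x := by
      unfold weight
      fun_prop
    have := hc.tendsto 0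
    simp only [weight] at this ⊢
    norm_num at this
    exact this.mono_left nhdsWithin_le_nhds

/-- The mass concentrates at scale `s`: with `x = s y` the integrand becomes `(1 - s²y²)^α exp
(-1/y²) / y²` on `|y| ≤ 1/s`, dominated by `1 / (1 + y²)`. -/
theorem tendsto_mul_integral_weight_sq_div :
    Tendsto (fun s : ℝ => s * ∫ x in (-1 : ℝ)..1, (1 : ℝ[X]).eval x * weight α (s ^ 2) x / x ^ 2)
      (𝓝[>] 0) (𝓝 √Real.pi) := by
  have key : Tendsto (fun s : ℝ => ∫ y : ℝ, (Ioc (-s⁻¹) s⁻¹).indicator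
      (fun y => (1 - (s * y) ^ 2) ^ α * Real.exp (-1 / y ^ 2) / y ^ 2) y) (𝓝[>] 0)
      (𝓝 (∫ y : ℝ, Real.exp (-1 / y ^ 2) / y ^ 2)) := by
    refine tendsto_integral_filter_of_dominated_convergence (fun y => (1 + y ^ 2)⁻¹) ?_ ?_
      integrable_inv_one_add_sq ?_
    · refine Eventually.of_forall fun s => ?_
      refine Measurable.aestronglyMeasurable (Measurable.indicator ?_ measurableSet_Ioc)
      fun_prop
    · filter_upwards [self_mem_nhdsWithin] with s hs
      have hs : 0 < s := hs
      refine Eventually.of_forall fun y => ?_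
      by_cases hy : y ∈ Ioc (-s⁻¹) s⁻¹
      · rw [indicator_of_mem hy]
        have hsy : s * y ∈ Icc (-1 : ℝ) 1 := by
          constructor
          · have := mul_le_mul_of_nonneg_left hy.1.le hs.le
            rwa [mul_neg, mul_inv_cancel₀ hs.ne'] at this
          · have := mul_le_mul_of_nonneg_left hy.2 hs.le
            rwa [mul_inv_cancel₀ hs.ne'] at this
        have h0 := one_sub_sq_nonneg hsy
        have h1 : (1 - (s * y) ^ 2) ^ α ≤ 1 :=
          Real.rpow_le_one h0 (by nlinarith [sq_nonneg (s * y)]) hα.le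
        rw [Real.norm_of_nonneg (by positivity), mul_div_assoc]
        refine le_trans ?_ (exp_neg_inv_sq_div_le y)
        exact mul_le_of_le_one_left (by positivity) h1
      · rw [indicator_of_notMem hy, norm_zero]
        positivity
    · refine Eventually.of_forall fun y => ?_
      have hc : Continuous fun s : ℝ => (1 - (s * y) ^ 2) ^ α * Real.exp (-1 / y ^ 2) / y ^ 2 := by
        refine ((Continuous.rpow_const (by fun_prop) fun _ => Or.inr hα.le).mul
          continuous_const).div_const _
      have h1 := (hc.tendsto 0).mono_left (nhdsWithin_le_nhds (s := Ioi 0))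
      simp only [zero_mul, ne_eq, OfNat.ofNat_ne_zero, not_false_eq_true, zero_pow, sub_zero,
        Real.one_rpow, one_mul] at h1
      refine h1.congr' ?_
      have hinv : Tendsto (fun s : ℝ => s⁻¹) (𝓝[>] 0) atTop := tendsto_inv_nhdsGT_zero
      filter_upwards [hinv.eventually_gt_atTop |y|] with s hs
      rw [indicator_of_mem]
      exact ⟨(abs_lt.mp hs).1, (abs_lt.mp hs).2.le⟩
  rw [integral_exp_neg_inv_sq_div] at key
  refine key.congr' ?_
  filter_upwards [self_mem_nhdsWithin] with s hs
  have hs : 0 < s := hs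
  have hsi : 0 < s⁻¹ := inv_pos.mpr hs
  have h1 := intervalIntegral.integral_comp_mul_left (a := -s⁻¹) (b := s⁻¹)
    (fun x => (1 : ℝ[X]).eval x * weight α (s ^ 2) x / x ^ 2) hs.ne'
  rw [mul_neg, mul_inv_cancel₀ hs.ne', smul_eq_mul] at h1
  have h2 : ∫ x in (-1 : ℝ)..1, (1 : ℝ[X]).eval x * weight α (s ^ 2) x / x ^ 2 =
      s * ∫ y in -s⁻¹..s⁻¹, (1 : ℝ[X]).eval (s * y) * weight α (s ^ 2) (s * y) / (s * y) ^ 2 := by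
    rw [h1, ← mul_assoc, mul_inv_cancel₀ hs.ne', one_mul]
  rw [h2, integral_indicator measurableSet_Ioc,
    ← intervalIntegral.integral_of_le (by linarith), ← mul_assoc,
    ← intervalIntegral.integral_const_mul]
  congr 1; ext y
  rcases eq_or_ne y 0 with rfl | hy
  · simp
  · simp only [eval_one, one_mul, weight]
    rw [show -s ^ 2 / (s * y) ^ 2 = -1 / y ^ 2 by field_simp]
    field_simp

theorem hasDerivAt_integral_weight_sq {s : ℝ} (hs : 0 < s) :
    HasDerivAt (fun s : ℝ => ∫ x in (-1 : ℝ)..1, (1 : ℝ[X]).eval x * weight α (s ^ 2) x / x ^ 0)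
      (-2 * (s * ∫ x in (-1 : ℝ)..1, (1 : ℝ[X]).eval x * weight α (s ^ 2) x / x ^ 2)) s := by
  have hs2 : 0 < s ^ 2 := by positivity
  have h := HasDerivAt.comp (h := fun s : ℝ => s ^ 2) s (hasDerivAt_laurentInt hα hs2 0 1)
    (hasDerivAt_pow 2 s)
  refine h.congr_deriv ?_
  rw [laurentInt_apply]
  norm_num
  ring

/-- Removes the moment of index `-4`, which appears on differentiating `s ∫ w / x²`, and so closes
the system. -/
theorem pearson_one {t : ℝ} (ht : 0 < t) : laurentInt hα ht 2 1 - 2 * t * laurentInt hα ht 4 1 =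
    -(2 * t * laurentInt hα ht 2 1) - (1 + 2 * α) * laurentInt hα ht 0 1 := by
  have hp := laurentInt_pearson hα ht 1 1
  have h1 : laurentInt hα ht 1 X = laurentInt hα ht 0 1 := by
    rw [← laurentInt_succ_X_mul hα ht 0 1, mul_one]
  have h2 : ∀ k, laurentInt hα ht (k + 2) (X ^ 2) = laurentInt hα ht k 1 := fun k => by
    rw [← laurentInt_succ_X_mul hα ht k, ← laurentInt_succ_X_mul hα ht (k + 1), mul_one, sq]
  have h3 := h2 0
  have h4 := h2 2
  rw [derivative_one, zero_mul, map_zero, one_mul, mul_one] at hp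
  norm_num [map_sub, h1] at hp h3 h4
  rw [h3, h4] at hp
  linear_combination -hp

theorem hasDerivAt_mul_integral_weight_sq_div {s : ℝ} (hs : 0 < s) :
    HasDerivAt
      (fun s : ℝ => s * ∫ x in (-1 : ℝ)..1, (1 : ℝ[X]).eval x * weight α (s ^ 2) x / x ^ 2)
      (-2 * s * (s * ∫ x in (-1 : ℝ)..1, (1 : ℝ[X]).eval x * weight α (s ^ 2) x / x ^ 2) -
        (1 + 2 * α) * ∫ x in (-1 : ℝ)..1, (1 : ℝ[X]).eval x * weight α (s ^ 2) x / x ^ 0) s := by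
  have hs2 : 0 < s ^ 2 := by positivity
  have h := (hasDerivAt_id s).mul
    (HasDerivAt.comp (h := fun s : ℝ => s ^ 2) s (hasDerivAt_laurentInt hα hs2 2 1)
      (hasDerivAt_pow 2 s))
  have hp := pearson_one hα hs2
  refine h.congr_deriv ?_
  rw [laurentInt_apply, laurentInt_apply] at hp
  simp only [laurentInt_apply, Function.comp_apply, id] at hp ⊢
  norm_num at hp ⊢
  linear_combination hp

/-- The factor `Γ(3/2 + α) / √π` scales the limits at `0⁺` to `Γ(1 + α)` and `Γ(3/2 + α)`, the
values of the Kummer combinations at `0`. -/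
theorem integral_weight_sq_eq_kummer {s : ℝ} (hs : 0 < s) :
    Real.Gamma (3 / 2 + α) / √Real.pi *
        ∫ x in (-1 : ℝ)..1, (1 : ℝ[X]).eval x * weight α (s ^ 2) x / x ^ 0 =
      Real.Gamma (1 + α) * kummer (-(1 / 2) - α) (1 / 2) (-s ^ 2) -
        2 * s * Real.Gamma (3 / 2 + α) * kummer (-α) (3 / 2) (-s ^ 2) ∧
    Real.Gamma (3 / 2 + α) / √Real.pi *
        (s * ∫ x in (-1 : ℝ)..1, (1 : ℝ[X]).eval x * weight α (s ^ 2) x / x ^ 2) =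
      Real.Gamma (3 / 2 + α) * kummer (-α) (1 / 2) (-s ^ 2) -
        (1 + 2 * α) * s * Real.Gamma (1 + α) * kummer (1 / 2 - α) (3 / 2) (-s ^ 2) := by
  set Γ₁ := Real.Gamma (1 + α)
  set Γ₂ := Real.Gamma (3 / 2 + α)
  set g : ℝ → ℝ := fun s => Γ₁ * kummer (-(1 / 2) - α) (1 / 2) (-s ^ 2) -
    2 * s * Γ₂ * kummer (-α) (3 / 2) (-s ^ 2) with hg
  set w : ℝ → ℝ := fun s => Γ₂ * kummer (-α) (1 / 2) (-s ^ 2) -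
    (1 + 2 * α) * s * Γ₁ * kummer (1 / 2 - α) (3 / 2) (-s ^ 2) with hw
  have hΓ₂ : Γ₂ ≠ 0 := (Real.Gamma_pos_of_pos (by linarith)).ne'
  have hπ : √Real.pi ≠ 0 := (Real.sqrt_pos.mpr Real.pi_pos).ne'
  have dg : ∀ s, HasDerivAt g (-2 * w s) s := by
    intro s
    have h1 := (hasDerivAt_kummer_neg_sq half_add_natCast_ne_zero (-(1 / 2) - α) s).const_mul Γ₁
    have h2 := (hasDerivAt_mul_kummer_neg_sq (-α) s).const_mul (2 * Γ₂)
    have h3 := h1.sub h2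
    rw [show -(1 / 2) - α + 1 = 1 / 2 - α by ring, show (1 / 2 : ℝ) + 1 = 3 / 2 by norm_num] at h3
    have e : g = ((fun y => Γ₁ * kummer (-(1 / 2) - α) (1 / 2) (-y ^ 2)) -
        fun y => 2 * Γ₂ * (y * kummer (-α) (3 / 2) (-y ^ 2))) := by
      ext y; simp only [hg, Pi.sub_apply]; ring
    rw [e]
    refine h3.congr_deriv ?_
    simp only [hw]
    ring
  have dw : ∀ s, HasDerivAt w (-2 * s * w s - (1 + 2 * α) * g s) s := by
    intro s
    have h1 := (hasDerivAt_kummer_neg_sq half_add_natCast_ne_zero (-α) s).const_mul Γ₂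
    have h2 := (hasDerivAt_mul_kummer_neg_sq (1 / 2 - α) s).const_mul ((1 + 2 * α) * Γ₁)
    have h3 := h1.sub h2
    have k1 := mul_kummer_add_one_add_one half_add_natCast_ne_zero (-α) (-s ^ 2)
    have k2 := kummer_add_one_left_sub half_add_natCast_ne_zero (-(1 / 2) - α) (-s ^ 2)
    rw [show (1 / 2 : ℝ) + 1 = 3 / 2 by norm_num] at h3 k1 k2
    rw [show -(1 / 2) - α + 1 = 1 / 2 - α by ring] at k2
    have e : w = ((fun y => Γ₂ * kummer (-α) (1 / 2) (-y ^ 2)) -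
        fun y => (1 + 2 * α) * Γ₁ * (y * kummer (1 / 2 - α) (3 / 2) (-y ^ 2))) := by
      ext y; simp only [hw, Pi.sub_apply]; ring
    rw [e]
    refine h3.congr_deriv ?_
    simp only [hg, Pi.sub_apply]
    linear_combination (-4 * s * Γ₂) * k1 - (1 + 2 * α) * Γ₁ * k2
  have g0 : g 0 = Γ₁ := by simp [hg, kummer_zero]
  have w0 : w 0 = Γ₂ := by simp [hw, kummer_zero]
  have tg : Tendsto g (𝓝[>] 0) (𝓝 Γ₁) := by
    have := (dg 0).continuousAt.tendsto
    rw [g0] at this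
    exact this.mono_left nhdsWithin_le_nhds
  have tw : Tendsto w (𝓝[>] 0) (𝓝 Γ₂) := by
    have := (dw 0).continuousAt.tendsto
    rw [w0] at this
    exact this.mono_left nhdsWithin_le_nhds
  have tG := ((tendsto_integral_weight_sq hα).const_mul (Γ₂ / √Real.pi)).sub tg
  have tB := ((tendsto_mul_integral_weight_sq_div hα).const_mul (Γ₂ / √Real.pi)).sub tw
  rw [show Γ₂ / √Real.pi * (√Real.pi * Γ₁ / Γ₂) - Γ₁ = 0 by field_simp; ring] at tG
  rw [show Γ₂ / √Real.pi * √Real.pi - Γ₂ = 0 by field_simp; ring] at tB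
  have key := linear_system_eq_zero (κ := 1 + 2 * α)
    (fun s hs => (((hasDerivAt_integral_weight_sq hα hs).const_mul (Γ₂ / √Real.pi)).sub
      (dg s)).congr_deriv (by simp only [Pi.sub_apply]; ring))
    (fun s hs => (((hasDerivAt_mul_integral_weight_sq_div hα hs).const_mul (Γ₂ / √Real.pi)).sub
      (dw s)).congr_deriv (by simp only [Pi.sub_apply]; ring))
    tG tB hs
  exact ⟨sub_eq_zero.mp key.1, sub_eq_zero.mp key.2⟩

variable {t : ℝ} (ht : 0 < t)

/-- The zeroth moment in terms of Kummer functions. -/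
theorem laurentInt_zero_one : Real.Gamma (3 / 2 + α) / √Real.pi * laurentInt hα ht 0 1 =
    Real.Gamma (1 + α) * kummer (-(1 / 2) - α) (1 / 2) (-t) -
      2 * √t * Real.Gamma (3 / 2 + α) * kummer (-α) (3 / 2) (-t) := by
  have h := (integral_weight_sq_eq_kummer hα (Real.sqrt_pos.mpr ht)).1
  rwa [Real.sq_sqrt ht.le] at h

/-- The moment of index `-2` in terms of Kummer functions. -/
theorem laurentInt_two_one : Real.Gamma (3 / 2 + α) / √Real.pi * (√t * laurentInt hα ht 2 1) =
    Real.Gamma (3 / 2 + α) * kummer (-α) (1 / 2) (-t) -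
      (1 + 2 * α) * √t * Real.Gamma (1 + α) * kummer (1 / 2 - α) (3 / 2) (-t) := by
  have h := (integral_weight_sq_eq_kummer hα (Real.sqrt_pos.mpr ht)).2
  rwa [Real.sq_sqrt ht.le] at h

include ht

theorem bigR_zero : bigR α 0 t =
    2 * √t * (Real.Gamma (3 / 2 + α) * kummer (-α) (1 / 2) (-t) -
        (1 + 2 * α) * √t * Real.Gamma (1 + α) * kummer (1 / 2 - α) (3 / 2) (-t)) /
      (Real.Gamma (1 + α) * kummer (-(1 / 2) - α) (1 / 2) (-t) -
        2 * √t * Real.Gamma (3 / 2 + α) * kummer (-α) (3 / 2) (-t)) := by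
  rw [← laurentInt_zero_one hα ht, ← laurentInt_two_one hα ht, bigR_eq hα ht, sqNorm_eq hα ht,
    orthPoly_zero, one_mul]
  have h1 : laurentInt hα ht 0 1 ≠ 0 := by
    simpa using (laurentInt_mul_self_pos hα ht Even.zero (one_ne_zero (α := ℝ[X]))).ne'
  have hΓ : Real.Gamma (3 / 2 + α) ≠ 0 := (Real.Gamma_pos_of_pos (by linarith)).ne'
  have hπ : √Real.pi ≠ 0 := (Real.sqrt_pos.mpr Real.pi_pos).ne'
  have hst : √t * √t = t := Real.mul_self_sqrt ht.le
  field_simp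
  linear_combination -laurentInt hα ht 2 1 * hst

theorem bigR_one : bigR α 1 t =
    6 * t * ((3 + 2 * α) * Real.Gamma (1 + α) * kummer (-(1 / 2) - α) (1 / 2) (-t) -
        4 * √t * Real.Gamma (5 / 2 + α) * kummer (-α) (3 / 2) (-t)) /
      (3 * Real.Gamma (1 + α) * kummer (-(3 / 2) - α) (-(1 / 2)) (-t) +
        8 * t * √t * Real.Gamma (5 / 2 + α) * kummer (-α) (5 / 2) (-t)) := by
  have hst : √t * √t = t := Real.mul_self_sqrt ht.le
  have hΓ : Real.Gamma (3 / 2 + α) ≠ 0 := (Real.Gamma_pos_of_pos (by linarith)).ne'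
  have hπ : √Real.pi ≠ 0 := (Real.sqrt_pos.mpr Real.pi_pos).ne'
  have hα3 : 3 + 2 * α ≠ 0 := by linarith
  have hΓ5 : Real.Gamma (5 / 2 + α) = (3 / 2 + α) * Real.Gamma (3 / 2 + α) := by
    rw [← Real.Gamma_add_one (by linarith)]
    congr 1; ring
  have m0 := laurentInt_zero_one hα ht
  have m2 := laurentInt_two_one hα ht
  have hX : laurentInt hα ht 2 (X * X) = laurentInt hα ht 0 1 := by
    rw [laurentInt_succ_X_mul hα ht 1, ← laurentInt_succ_X_mul hα ht 0 1, mul_one]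
  -- This yields `(3 + 2α) ∫ x² w = (1 - 2t) ∫ w + 2t ∫ w / x²`, hence `h_1` from the two moments
  -- already known.
  have hp := laurentInt_pearson hα ht 0 X
  have hX3 : laurentInt hα ht 3 (X * (1 - X ^ 2)) = laurentInt hα ht 2 1 - laurentInt hα ht 0 1 := by
    rw [laurentInt_succ_X_mul hα ht 2, map_sub, sq, hX]
  rw [derivative_X, one_mul, zero_add, hX3, Nat.cast_zero, zero_mul, sub_zero, map_sub, sq] at hp
  have k1 := kummer_neg_half (-(3 / 2) - α) (-t)
  have k2 := kummer_five_halves (-α) (-t)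
  rw [show -(3 / 2) - α + 1 = -(1 / 2) - α by ring, show -(3 / 2) - α + 2 = 1 / 2 - α by ring] at k1
  have hnum : (3 + 2 * α) * Real.Gamma (1 + α) * kummer (-(1 / 2) - α) (1 / 2) (-t) -
      4 * √t * Real.Gamma (5 / 2 + α) * kummer (-α) (3 / 2) (-t) =
      (3 + 2 * α) * (Real.Gamma (3 / 2 + α) / √Real.pi * laurentInt hα ht 0 1) := by
    rw [hΓ5, m0]; ring
  have hden : 3 * Real.Gamma (1 + α) * kummer (-(3 / 2) - α) (-(1 / 2)) (-t) +
      8 * t * √t * Real.Gamma (5 / 2 + α) * kummer (-α) (5 / 2) (-t) =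
      3 * (3 + 2 * α) * (Real.Gamma (3 / 2 + α) / √Real.pi * laurentInt hα ht 0 (X * X)) := by
    rw [hΓ5, k1]
    linear_combination (-6 * √t * Real.Gamma (3 / 2 + α)) * k2 - 3 * (1 - 2 * t) * m0 -
      6 * √t * m2 + 3 * Real.Gamma (3 / 2 + α) / √Real.pi * hp +
      6 * ((1 + 2 * α) * Real.Gamma (1 + α) * kummer (1 / 2 - α) (3 / 2) (-t) +
        Real.Gamma (3 / 2 + α) / √Real.pi * laurentInt hα ht 2 1) * hst
  have h1 : laurentInt hα ht 0 (X * X) ≠ 0 :=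
    (laurentInt_mul_self_pos hα ht Even.zero X_ne_zero).ne'
  rw [hnum, hden, bigR_eq hα ht, sqNorm_eq hα ht, orthPoly_one hα ht, hX]
  field_simp
  ring

end InitialValues

end SingJacobi

end

open SingJacobi in
theorem theorem4p3 (α t : ℝ) (hα : 0 < α) (ht : 0 < t) :
    -- the logarithmic derivative defining `σ_n` makes sense
    (∀ n : ℕ, 0 < hankelDet α n t ∧ DifferentiableAt ℝ (hankelDet α n) t) ∧
    -- the difference equation; its denominators can vanish for odd `n` only
    (∀ n : ℕ, 1 ≤ n →
      (Odd n →
        (-1) ^ n * t * (2 * n + 1 + 2 * α) * (2 * n - 1 + 2 * α) +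
          (n + α) * (sigma α (n - 1) t - sigma α n t) * (sigma α n t - sigma α (n + 1) t) ≠ 0) →
      (n - (sigma α (n - 1) t - sigma α n t) * (sigma α n t - sigma α (n + 1) t) *
            (2 * α * (n - t) + 2 * (-1) ^ n * t * (n + α) + n ^ 2 + sigma α n t) /
          (2 * ((-1) ^ n * t * (2 * n + 1 + 2 * α) * (2 * n - 1 + 2 * α) +
            (n + α) * (sigma α (n - 1) t - sigma α n t) *
              (sigma α n t - sigma α (n + 1) t)))) *
        (n + 2 * α - (sigma α (n - 1) t - sigma α n t) * (sigma α n t - sigma α (n + 1) t) *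
            (2 * α * (n - t) + 2 * (-1) ^ n * t * (n + α) + n ^ 2 + sigma α n t) /
          (2 * ((-1) ^ n * t * (2 * n + 1 + 2 * α) * (2 * n - 1 + 2 * α) +
            (n + α) * (sigma α (n - 1) t - sigma α n t) *
              (sigma α n t - sigma α (n + 1) t)))) =
      t * (2 * n - 1 + 2 * α + sigma α (n - 1) t - sigma α n t) *
          (2 * n + 1 + 2 * α + sigma α n t - sigma α (n + 1) t) *
        ((2 * α * (n - t) + 2 * (-1) ^ n * t * (n + α) + n ^ 2 + sigma α n t) /
          (t * (2 * n + 1 + 2 * α) * (2 * n - 1 + 2 * α) +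
            (-1) ^ n * (n + α) * (sigma α (n - 1) t - sigma α n t) *
              (sigma α n t - sigma α (n + 1) t)))) ∧
    -- the initial conditions
    sigma α 1 t = -bigR α 0 t ∧
    sigma α 2 t = -(bigR α 0 t + bigR α 1 t) ∧
    bigR α 0 t =
      2 * √t * (Real.Gamma (3 / 2 + α) * kummer (-α) (1 / 2) (-t) -
          (1 + 2 * α) * √t * Real.Gamma (1 + α) * kummer (1 / 2 - α) (3 / 2) (-t)) /
        (Real.Gamma (1 + α) * kummer (-(1 / 2) - α) (1 / 2) (-t) -
          2 * √t * Real.Gamma (3 / 2 + α) * kummer (-α) (3 / 2) (-t)) ∧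
    bigR α 1 t =
      6 * t * ((3 + 2 * α) * Real.Gamma (1 + α) * kummer (-(1 / 2) - α) (1 / 2) (-t) -
          4 * √t * Real.Gamma (5 / 2 + α) * kummer (-α) (3 / 2) (-t)) /
        (3 * Real.Gamma (1 + α) * kummer (-(3 / 2) - α) (-(1 / 2)) (-t) +
          8 * t * √t * Real.Gamma (5 / 2 + α) * kummer (-α) (5 / 2) (-t)) := by
  refine ⟨fun n => ⟨hankelDet_pos hα ht n, differentiableAt_hankelDet hα ht n⟩,
    fun n hn hodd => sigma_difference_equation hα ht hn hodd, ?_, ?_, bigR_zero hα ht,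
    bigR_one hα ht⟩
  · rw [sigma_eq_neg_sum hα ht, Finset.sum_range_one]
  · rw [sigma_eq_neg_sum hα ht, Finset.sum_range_succ, Finset.sum_range_one]
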